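/- Let $\mathfrak S_n$ be the symmetric group on $\{1,\dots,n\}$. For $n\ge 0$ let $a_n^{\{1,3\}}(132)$ be the number of permutations $\pi=\pi_1\cdots\pi_n\in\mathfrak S_n$ all of whose cycles have length $1$ or $3$ (permutations "of order $3$", the identity included) and that avoid the pattern $132$, i.e. for which there are no $i<j<k$ with $\pi_i<\pi_k<\pi_j$. Let $$A^{\{1,3\}}_{132}(z)=\sum_{n\ge 0}a_n^{\{1,3\}}(132)\,z^n .$$ Let $c(x)=\sum_{n\ge0}C_nx^n$ be the generating function of the Catalan numbers $C_n=\frac1{n+1}\binom{2n}{n}$. A Motzkin path of length $k$ is a sequence of $k$ steps, each up ($+1$), flat ($0$) or down ($-1$), that starts and ends at height $0$ and never goes below height $0$. Let $M_{k,j}$ be the number of Motzkin paths of length $k$ with exactly $j$ flat steps at height $0$, and put $$M(t,x)=\sum_{k,j\ge0}M_{k,j}\,x^kt^j,\qquad F(t,x)=1+x\,t\,M(t,x).$$ **Theorem.** As formal power series in $z$ with rational coefficients, $$A^{\{1,3\}}_{132}(z)=\frac1{1-z}\,F\!\left(\frac{2}{1-z},\,c(z^3)-1\right),$$ and, equivalently,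 $$A^{\{1,3\}}_{132}(z)=\frac{c(z^3)}{\sqrt{c(z^3)\,\bigl(4-3c(z^3)\bigr)}-z\,c(z^3)},$$ where $\sqrt{c(z^3)(4-3c(z^3))}$ is the unique power series with constant term $1$ whose square is $c(z^3)(4-3c(z^3))$. -/

import Mathlib

noncomputable section

/-! ### Pattern avoidance and cycle lengths -/

/-- The permutation `π` of `{0, …, n-1}` contains the pattern `σ`: some subsequence of the one-line
notation of `π` is in the same relative order as `σ`. -/
def ContainsPattern {n k : ℕ} (π : Equiv.Perm (Fin n)) (σ : Equiv.Perm (Fin k)) : Prop :=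
  ∃ f : Fin k → Fin n, StrictMono f ∧ ∀ i j : Fin k, π (f i) < π (f j) ↔ σ i < σ j

/-- All cycles of `π` have length in `S`; fixed points are cycles of length `1`. -/
def HasCycleLengthsIn {n : ℕ} (S : Set ℕ) (π : Equiv.Perm (Fin n)) : Prop :=
  ∀ l ∈ π.partition.parts, l ∈ S

/-- The number of permutations of size `n` that avoid `σ` and all of whose cycle lengths
belong to `S`. -/
def numAvoiding {k : ℕ} (S : Set ℕ) (σ : Equiv.Perm (Fin k)) (n : ℕ) : ℕ :=
  Nat.card {π : Equiv.Perm (Fin n) // HasCycleLengthsIn S π ∧ ¬ ContainsPattern π σ}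

/-- The generating function `∑ₙ aₙ zⁿ` of the numbers `numAvoiding S σ n`. -/
def avoidingSeries {k : ℕ} (S : Set ℕ) (σ : Equiv.Perm (Fin k)) : PowerSeries ℚ :=
  PowerSeries.mk fun n => (numAvoiding S σ n : ℚ)

/-- The pattern `132` (in zero-based one-line notation, `0 2 1`). -/
def pattern132 : Equiv.Perm (Fin 3) := Equiv.swap 1 2

/-! ### Motzkin paths -/

/-- The steps of a Motzkin path. -/
inductive MotzkinStep
  | up
  | flat
  | down

/-- The change of height along a step. -/
def MotzkinStep.rise : MotzkinStep → ℤ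
  | .up => 1
  | .flat => 0
  | .down => -1

/-- The final height of a path that starts at height `0`. -/
def pathHeight (w : List MotzkinStep) : ℤ := (w.map MotzkinStep.rise).sum

/-- A Motzkin path: it starts and ends at height `0` and never goes below height `0`. -/
def IsMotzkinPath (w : List MotzkinStep) : Prop :=
  pathHeight w = 0 ∧ ∀ i ≤ w.length, 0 ≤ pathHeight (w.take i)

/-- The number of flat steps of the path that lie at height `0`. -/
def flatsAtLevelZero (w : List MotzkinStep) : ℕ :=
  Nat.card {i : Fin w.length // w.get i = MotzkinStep.flat ∧ pathHeight (w.take i) = 0}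

/-- The number of Motzkin paths of length `k` with exactly `j` flats at level zero. -/
def motzkinCount (k j : ℕ) : ℕ :=
  Nat.card {w : List MotzkinStep // w.length = k ∧ IsMotzkinPath w ∧ flatsAtLevelZero w = j}

/-- There are finitely many words of a given length, so `motzkinCount` is a true count. -/
theorem finite_motzkinWords (k j : ℕ) :
    Finite {w : List MotzkinStep // w.length = k ∧ IsMotzkinPath w ∧ flatsAtLevelZero w = j} := by
  have : Finite MotzkinStep :=
    Finite.of_surjective (fun i : Fin 3 => ![MotzkinStep.up, .flat, .down] i) (by
      intro s
      cases s
      · exact ⟨0, rfl⟩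
      · exact ⟨1, rfl⟩
      · exact ⟨2, rfl⟩)
  exact ((List.finite_length_eq MotzkinStep k).subset fun w hw => hw.1).to_subtype

/-- A path of length `k` has at most `k` flats at level zero. -/
theorem motzkinCount_eq_zero {k j : ℕ} (h : k < j) : motzkinCount k j = 0 := by
  have : IsEmpty {w : List MotzkinStep //
      w.length = k ∧ IsMotzkinPath w ∧ flatsAtLevelZero w = j} := by
    refine ⟨fun ⟨w, hk, _, hj⟩ => ?_⟩
    have h2 := Finite.card_subtype_le
      (fun i : Fin w.length => w.get i = MotzkinStep.flat ∧ pathHeight (w.take i) = 0)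
    rw [Nat.card_fin] at h2
    unfold flatsAtLevelZero at hj
    omega
  exact Nat.card_of_isEmpty

/-! ### Series in `x` over polynomials in `t` -/

/-- The bivariate generating function `M(t, x) = ∑_{k, j} M_{k, j} xᵏ tʲ` of Motzkin paths by length
and number of flats at level zero. It is a power series in `x` whose coefficients are polynomials
in `t`, because `M_{k, j} = 0` for `j > k`. -/
def motzkinSeries : PowerSeries (Polynomial ℚ) :=
  PowerSeries.mk fun k =>
    ∑ j ∈ Finset.range (k + 1), Polynomial.C (motzkinCount k j : ℚ) * Polynomial.X ^ j

/-- `F(t, x) = 1 + x t M(t, x)`. -/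
def seriesF : PowerSeries (Polynomial ℚ) :=
  1 + PowerSeries.X * PowerSeries.C (Polynomial.X : Polynomial ℚ) * motzkinSeries

/-- The partial sum `∑_{k < N} Gₖ(t) xᵏ` of `G(t, x)`, for power series `t`, `x` in `z`. -/
def partialEval (G : PowerSeries (Polynomial ℚ)) (t x : PowerSeries ℚ) (N : ℕ) : PowerSeries ℚ :=
  ∑ k ∈ Finset.range N, Polynomial.aeval t (PowerSeries.coeff k G) * x ^ k

/-- The power series `G(t(z), x(z)) = ∑ₖ Gₖ(t(z)) x(z)ᵏ`, where `G(t, x) = ∑ₖ Gₖ(t) xᵏ` has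
polynomial coefficients in `t` and `x(z)` has no constant term. As `x(z)ᵏ` is divisible by `zᵏ`,
only the terms with `k ≤ n` contribute to the coefficient of `zⁿ`. -/
def evalSeries (G : PowerSeries (Polynomial ℚ)) (t x : PowerSeries ℚ) : PowerSeries ℚ :=
  PowerSeries.mk fun n => PowerSeries.coeff n (partialEval G t x (n + 1))

/-- If `x` has no constant term, the partial sums stabilise coefficientwise at `evalSeries`. -/
theorem coeff_partialEval_eq (G : PowerSeries (Polynomial ℚ)) (t x : PowerSeries ℚ)
    (hx : PowerSeries.constantCoeff x = 0) {n N : ℕ} (h : n < N) :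
    PowerSeries.coeff n (partialEval G t x N) = PowerSeries.coeff n (evalSeries G t x) := by
  rw [evalSeries, PowerSeries.coeff_mk, partialEval, partialEval, map_sum, map_sum]
  symm
  refine Finset.sum_subset (Finset.range_subset_range.2 h) fun k _ hk => ?_
  have hnk : n < k := by simpa [Nat.lt_succ_iff] using hk
  have hd : (PowerSeries.X : PowerSeries ℚ) ^ k ∣
      Polynomial.aeval t (PowerSeries.coeff k G) * x ^ k :=
    Dvd.dvd.mul_left (pow_dvd_pow_of_dvd (PowerSeries.X_dvd_iff.2 hx) k) _
  exact PowerSeries.X_pow_dvd_iff.1 hd n hnk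

/-! ### The Catalan generating function and square roots -/

/-- `c(z³)`, where `c` is the generating function of the Catalan numbers. -/
def catalanCube : PowerSeries ℚ :=
  PowerSeries.expand 3 (by norm_num)
    (PowerSeries.map (Nat.castRingHom ℚ) PowerSeries.catalanSeries)

/-- The series `c(z³) - 1` has no constant term. -/
theorem constantCoeff_catalanCube_sub_one :
    PowerSeries.constantCoeff (catalanCube - 1) = 0 := by
  rw [catalanCube, map_sub, PowerSeries.constantCoeff_expand,
    ← PowerSeries.coeff_zero_eq_constantCoeff_apply, PowerSeries.coeff_map]
  simp

/-- `s` is the square root of `f` with constant term `1`. -/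
def IsSqrtSeries (s f : PowerSeries ℚ) : Prop :=
  s ^ 2 = f ∧ PowerSeries.constantCoeff s = 1

end

/-!
Both formulas follow from `A * (1 - z - 2w) = 1`, where `A` is the series of the avoiders, `u =
z³ c(z³)`, and `w` is the solution of `w = u + w²` without constant term.

*Structure of the avoiders.* Let `f` be a `132`-avoiding permutation of `{0, …, N}` with `f³ =
1`. If `N` is a fixed point, it may be deleted. Otherwise the cycle of `N` is `p ↦ N ↦ q ↦ p`,
and since `f²` is an avoider as well, `p < q` may be assumed at the cost of a factor `2`
(`card_cubicAvoiders_succ`). Then the elements `0, …, p`, the `p + 1` elements that end in `q`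
and the `p + 1` highest elements are permuted cyclically as blocks `A → B → C → A`, where `A` is
lowest, `B` highest and `C` ends in `q`: the map `A → B` is a `132`-avoider followed by its
maximum, `B → C` is increasing, and `C → A` is determined by `f³ = 1` (`exists_eq_insertBlock`).
Deleting the blocks leaves an avoider `f'`. Conversely, given `f'` and the block, only the
position of `C` can be chosen. The admissible positions are the gaps of `f'`
(`insertBlock_avoids`), and if `f'` has the gaps `0 = k₀ < k₁ < ⋯`, then insertion at `kⱼ`
yields a permutation with the gaps `0` and `a + k₀, …, a + kⱼ`, where `a` is the size of `A`
(`isGap_insertBlock_iff`). Insertion at the gap of rank `i` therefore is a bijection onto the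
avoiders with exactly `i + 1` gaps (`insertBlockAtRank_bijective`). As the `132`-avoiders are
counted by the Catalan numbers (`finite_and_card_avoiders`), the blocks have the generating
function `u`.

*Generating functions.* Let `Bᵢ` be the series of the avoiders with at least `i` gaps. The
bijection says `Bᵢ₊₁ - Bᵢ₊₂ = u Bᵢ` for `i ≥ 1`, which together with `Bᵢ → 0` forces `B₂ = w B₁`
(`gapSeries_two_eq`). Since `B₁ = A` and `A = 1 + z A + 2 B₂`, the formula for `A` follows. The
square root in the second formula is `c(z³) (1 - 2w)`.

*Motzkin paths.* Let `Pₕ` be the series of the paths from height `h` to height `0`. Removing the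
first step gives a linear recursion for the `Pₕ`, which by the same argument implies `P₁ = y P₀`
for the small solution `y` of `y = x (1 + y + y²)` (`pathEval_one`), hence `M (1 - x t - x y) =
1`. For `x = c(z³) - 1` the solution is `y = c(u) - 1`, and both formulas become polynomial
identities in `z`, `c(z³)` and `c(u)`.
-/

/-! ### Permutations avoiding 132 are counted by the Catalan numbers -/

/-- The function `f` has no three arguments in the relative position `132`. -/
def Avoids132 (f : ℕ → ℕ) : Prop :=
  ∀ i j k, i < j → j < k → f i < f k → f k < f j → False

/-- The `132`-avoiding permutations of `{0, …, n-1}`, extended to `ℕ` by fixed points. Such an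
extension creates no new occurrence of the pattern. -/
def avoiders (n : ℕ) : Set (Equiv.Perm ℕ) :=
  {f | (∀ x, n ≤ x → f x = x) ∧ Avoids132 f}

theorem lt_of_fixes_from {n : ℕ} {f : ℕ → ℕ} (hf : Function.Injective f)
    (h : ∀ x, n ≤ x → f x = x) {x : ℕ} (hx : x < n) : f x < n := by
  by_contra hc
  have := hf (h (f x) (by omega))
  omega

theorem symm_fixes_from {n : ℕ} {f : Equiv.Perm ℕ} (h : ∀ x, n ≤ x → f x = x) (x : ℕ)
    (hx : n ≤ x) : f.symm x = x := by
  rw [Equiv.symm_apply_eq, h x hx]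

theorem Avoids132.symm {f : Equiv.Perm ℕ} (h : Avoids132 f) : Avoids132 f.symm := by
  intro i j k hij hjk h1 h2
  exact h _ _ _ h1 h2 (by simpa using hij) (by simpa using hjk)

/-- If the first `m` values of a permutation of `{0, …, n-1}` exceed all the others, they are the
`m` largest ones. -/
theorem lt_iff_of_forall_lt {n m : ℕ} {f : ℕ → ℕ} (hf : Function.Injective f)
    (h : ∀ x, n ≤ x → f x = x) (hmn : m ≤ n)
    (hm : ∀ i k, i < m → m ≤ k → k < n → f k < f i) {x : ℕ} (hx : x < n) :
    x < m ↔ n - m ≤ f x := by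
  have hlt : ∀ y, y < n → f y < n := fun y hy => lt_of_fixes_from hf h hy
  constructor
  · intro hxm
    have hsub : (Finset.Ico m n).image f ⊆ Finset.range (f x) := by
      intro y hy
      simp only [Finset.mem_image, Finset.mem_Ico] at hy
      obtain ⟨k, hk, rfl⟩ := hy
      exact Finset.mem_range.2 (hm x k hxm hk.1 hk.2)
    have := Finset.card_le_card hsub
    rwa [Finset.card_image_of_injective _ hf, Nat.card_Ico, Finset.card_range] at this
  · intro hfx
    by_contra hxm
    have hsub : (Finset.range m).image f ⊆ Finset.Ioo (f x) n := by
      intro y hy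
      simp only [Finset.mem_image, Finset.mem_range] at hy
      obtain ⟨i, hi, rfl⟩ := hy
      exact Finset.mem_Ioo.2 ⟨hm i x hi (by omega) hx, hlt i (by omega)⟩
    have := Finset.card_le_card hsub
    rw [Finset.card_image_of_injective _ hf, Nat.card_Ioo, Finset.card_range] at this
    have := hlt x hx
    omega

/-- The elements of a `132`-avoider before its maximum are larger than those after it. -/
theorem lt_iff_of_maximum {n p : ℕ} {f : ℕ → ℕ} (hf : Function.Injective f)
    (h : ∀ x, n + 1 ≤ x → f x = x) (hp : p ≤ n) (hfp : f p = n) (ha : Avoids132 f)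
    {x : ℕ} (hx : x ≤ n) : x ≤ p ↔ n - p ≤ f x := by
  have := lt_iff_of_forall_lt (n := n + 1) (m := p + 1) hf h (by omega) (x := x) ?_ (by omega)
  · omega
  · intro i k hi hk hkn
    have hk' := lt_of_fixes_from hf h hkn
    have hne : f k ≠ n := by
      rw [← hfp]; exact fun hc => by have := hf hc; omega
    rcases Nat.lt_succ_iff_lt_or_eq.1 hi with hi | rfl
    · have hne' : f k ≠ f i := fun hc => by have := hf hc; omega
      by_contra hc
      exact ha i p k hi (by omega) (by omega) (by omega)
    · omega

/-- The permutation `L n R`: the `132`-avoider of size `p + r + 1` with maximum at position `p`,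
the pattern `L` before it and the pattern `R` after it. -/
def glue {p r : ℕ} (L : avoiders p) (R : avoiders r) : Equiv.Perm ℕ where
  toFun x := if x < p then L.1 x + r else if x = p then p + r else
    if x ≤ p + r then R.1 (x - (p + 1)) else x
  invFun y := if y < r then R.1.symm y + (p + 1) else if y < p + r then L.1.symm (y - r) else
    if y = p + r then p else y
  left_inv x := by
    have hL : ∀ x, x < p → L.1 x < p := fun x hx => lt_of_fixes_from L.1.injective L.2.1 hx
    have hR : ∀ x, x < r → R.1 x < r := fun x hx => lt_of_fixes_from R.1.injective R.2.1 hx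
    have h1 := hL x
    have h2 := hR (x - (p + 1))
    by_cases hx : x < p
    · have : ¬ (L.1 x + r < r) := by omega
      have h3 : L.1 x + r < p + r := by omega
      simp [hx, h3]
    · by_cases hxp : x = p
      · simp [hxp]
      · by_cases hxr : x ≤ p + r
        · have h3 : R.1 (x - (p + 1)) < r := by omega
          simp [hx, hxp, hxr, h3]; omega
        · have h3 : ¬ x < r := by omega
          have h4 : ¬ x < p + r := by omega
          have h5 : ¬ x = p + r := by omega
          simp [hx, hxp, hxr, h3, h4, h5]
  right_inv y := by
    have hL : ∀ x, x < p → L.1.symm x < p :=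
      fun x hx => lt_of_fixes_from L.1.symm.injective (symm_fixes_from L.2.1) hx
    have hR : ∀ x, x < r → R.1.symm x < r :=
      fun x hx => lt_of_fixes_from R.1.symm.injective (symm_fixes_from R.2.1) hx
    have h1 := hL (y - r)
    have h2 := hR y
    by_cases hy : y < r
    · have h3 : ¬ R.1.symm y + (p + 1) < p := by omega
      have h4 : ¬ R.1.symm y + (p + 1) = p := by omega
      have h5 : R.1.symm y + (p + 1) ≤ p + r := by omega
      simp [hy, h3, h4, h5]
    · by_cases hy2 : y < p + r
      · have h3 : L.1.symm (y - r) < p := by omega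
        simp [hy, hy2, h3]; omega
      · by_cases hy3 : y = p + r
        · simp [hy3]
        · have h3 : ¬ y < p := by omega
          have h4 : ¬ y = p := by omega
          have h5 : ¬ y ≤ p + r := by omega
          simp [hy, hy2, hy3, h3, h4, h5]

theorem glue_apply {p r : ℕ} (L : avoiders p) (R : avoiders r) (x : ℕ) :
    glue L R x = if x < p then L.1 x + r else if x = p then p + r else
    if x ≤ p + r then R.1 (x - (p + 1)) else x := rfl

theorem glue_mem {p r : ℕ} (L : avoiders p) (R : avoiders r) : glue L R ∈ avoiders (p + r + 1) := by
  have hL : ∀ x, x < p → L.1 x < p := fun x hx => lt_of_fixes_from L.1.injective L.2.1 hx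
  have hR : ∀ x, x < r → R.1 x < r := fun x hx => lt_of_fixes_from R.1.injective R.2.1 hx
  constructor
  · intro x hx
    rw [glue_apply, if_neg (by omega), if_neg (by omega), if_neg (by omega)]
  · intro i j k hij hjk h1 h2
    have hl := L.2.2 i j k hij hjk
    have hr := R.2.2 (i - (p + 1)) (j - (p + 1)) (k - (p + 1))
    have := hL i; have := hL j; have := hL k
    have := hR (i - (p + 1)); have := hR (j - (p + 1)); have := hR (k - (p + 1))
    simp only [glue_apply] at h1 h2
    split_ifs at h1 h2 <;> first
      | omega
      | exact hl (by omega) (by omega)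
      | exact hr (by omega) (by omega) (by omega) (by omega)

theorem glue_maximum {p r : ℕ} (L : avoiders p) (R : avoiders r) : glue L R p = p + r := by
  simp [glue_apply]

theorem glue_bijective (n : ℕ) : Function.Bijective
    (fun t : Σ ij : Finset.HasAntidiagonal.antidiagonal n, avoiders ij.1.1 × avoiders ij.1.2 =>
      (⟨glue t.2.1 t.2.2, by
        have := glue_mem t.2.1 t.2.2
        rwa [Finset.HasAntidiagonal.mem_antidiagonal.1 t.1.2] at this⟩ : avoiders (n + 1))) := by
  constructor
  · rintro ⟨⟨⟨p, r⟩, h⟩, L, R⟩ ⟨⟨⟨p', r'⟩, h'⟩, L', R'⟩ he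
    simp only [Subtype.mk.injEq] at he
    dsimp only at L R L' R'
    have hn := Finset.HasAntidiagonal.mem_antidiagonal.1 h
    have hn' := Finset.HasAntidiagonal.mem_antidiagonal.1 h'
    simp only at hn hn'
    have h1 := glue_maximum L R
    have h2 := glue_maximum L' R'
    rw [← he, hn', ← hn, ← h1] at h2
    have hp := (glue L R).injective h2
    subst hp
    have hr : r' = r := by omega
    subst hr
    have hLL : L = L' := by
      apply Subtype.ext; ext x
      by_cases hx : x < p'
      · have := congrArg (fun g : Equiv.Perm ℕ => g x) he
        simpa [glue_apply, hx] using this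
      · rw [L.2.1 x (by omega), L'.2.1 x (by omega)]
    have hRR : R = R' := by
      apply Subtype.ext; ext x
      by_cases hx : x < r'
      · have := congrArg (fun g : Equiv.Perm ℕ => g (x + (p' + 1))) he
        have h3 : ¬ x + (p' + 1) < p' := by omega
        have h4 : ¬ x + (p' + 1) = p' := by omega
        have h5 : x + (p' + 1) ≤ p' + r' := by omega
        simpa [glue_apply, h3, h4, h5] using this
      · rw [R.2.1 x (by omega), R'.2.1 x (by omega)]
    rw [hLL, hRR]
  · rintro ⟨f, hf, ha⟩
    set p := f.symm n with hp
    have hfp : f p = n := by simp [hp]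
    have hpn : p ≤ n := by
      have := lt_of_fixes_from f.symm.injective (symm_fixes_from hf) (Nat.lt_succ_self n)
      omega
    have key : ∀ x, x ≤ n → (x ≤ p ↔ n - p ≤ f x) := fun x hx =>
      lt_iff_of_maximum f.injective hf hpn hfp ha hx
    have hlt : ∀ x, x ≤ n → f x ≤ n := fun x hx =>
      Nat.lt_succ_iff.1 (lt_of_fixes_from f.injective hf (Nat.lt_succ_of_le hx))
    have hlt' : ∀ x, x ≤ n → f.symm x ≤ n := fun x hx =>
      Nat.lt_succ_iff.1 (lt_of_fixes_from f.symm.injective (symm_fixes_from hf)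
        (Nat.lt_succ_of_le hx))
    have hne : ∀ x, x ≠ p → f x ≠ n := fun x hx hc => hx (f.injective (hc.trans hfp.symm))
    have hne' : ∀ x, x ≠ n → f.symm x ≠ p := fun x hx hc => hx (f.symm.injective hc)
    let L : Equiv.Perm ℕ :=
      { toFun := fun x => if x < p then f x - (n - p) else x
        invFun := fun y => if y < p then f.symm (y + (n - p)) else y
        left_inv := by
          intro x
          by_cases hx : x < p
          · have h1 := (key x (by omega)).1 (by omega)
            have h2 := hlt x (by omega)
            have h3 := hne x (by omega)
            have h4 : f x - (n - p) < p := by omega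
            have h5 : f x - (n - p) + (n - p) = f x := by omega
            simp only [hx, h4, h5, if_true, Equiv.symm_apply_apply]
          · simp [hx]
        right_inv := by
          intro y
          by_cases hy : y < p
          · have h1 := hlt' (y + (n - p)) (by omega)
            have h2 := key _ h1
            have h3 := hne' (y + (n - p)) (by omega)
            rw [Equiv.apply_symm_apply] at h2
            have h4 : f.symm (y + (n - p)) < p := by omega
            simp [hy, h4]
          · simp [hy] }
    let R : Equiv.Perm ℕ :=
      { toFun := fun x => if x < n - p then f (x + (p + 1)) else x
        invFun := fun y => if y < n - p then f.symm y - (p + 1) else y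
        left_inv := by
          intro x
          by_cases hx : x < n - p
          · have h1 := key (x + (p + 1)) (by omega)
            have h4 : f (x + (p + 1)) < n - p := by omega
            simp [hx, h4]
          · simp [hx]
        right_inv := by
          intro y
          by_cases hy : y < n - p
          · have h1 := hlt' y (by omega)
            have h2 := key _ h1
            rw [Equiv.apply_symm_apply] at h2
            have h4 : f.symm y - (p + 1) < n - p := by omega
            have h5 : f.symm y - (p + 1) + (p + 1) = f.symm y := by omega
            simp only [hy, h4, h5, if_true, Equiv.apply_symm_apply]
          · simp [hy] }
    have hLa : ∀ x, L x = if x < p then f x - (n - p) else x := fun _ => rfl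
    have hRa : ∀ x, R x = if x < n - p then f (x + (p + 1)) else x := fun _ => rfl
    have hL : L ∈ avoiders p := by
      refine ⟨fun x hx => by rw [hLa, if_neg (by omega)], ?_⟩
      intro i j k hij hjk h1 h2
      rw [hLa, hLa] at h1 h2
      have := hlt j; have := key i; have := key j; have := key k
      split_ifs at h1 h2 <;> first | omega | exact ha i j k hij hjk (by omega) (by omega)
    have hR : R ∈ avoiders (n - p) := by
      refine ⟨fun x hx => by rw [hRa, if_neg (by omega)], ?_⟩
      intro i j k hij hjk h1 h2
      rw [hRa, hRa] at h1 h2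
      have := key (j + (p + 1)); have := key (k + (p + 1))
      split_ifs at h1 h2 <;> first
        | omega
        | exact ha _ _ _ (Nat.add_lt_add_right hij (p + 1)) (Nat.add_lt_add_right hjk (p + 1)) h1 h2
    refine ⟨⟨⟨(p, n - p), by simp; omega⟩, ⟨L, hL⟩, ⟨R, hR⟩⟩, ?_⟩
    apply Subtype.ext
    ext x
    change glue (⟨L, hL⟩ : avoiders p) (⟨R, hR⟩ : avoiders (n - p)) x = f x
    rw [glue_apply]
    simp only [hLa, hRa]
    have hk := key x
    split_ifs with h1 h2 h3 h4
    · have := hk (by omega); omega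
    · subst h2; omega
    · rw [show x - (p + 1) + (p + 1) = x by omega]
    · omega
    · exact (hf x (by omega)).symm

theorem finite_and_card_avoiders (n : ℕ) :
    Finite (avoiders n) ∧ Nat.card (avoiders n) = catalan n := by
  induction n using Nat.strong_induction_on with
  | _ n ih =>
    cases n with
    | zero =>
      have : avoiders 0 = {1} := by
        ext f
        constructor
        · intro h; ext x; exact h.1 x (Nat.zero_le x)
        · rintro rfl
          exact ⟨fun _ _ => rfl, fun i j k h1 h2 h3 h4 => by
            simp only [Equiv.Perm.coe_one, id] at h3 h4; omega⟩
      rw [this]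
      exact ⟨inferInstance, by simp⟩
    | succ n =>
      have e := Equiv.ofBijective _ (glue_bijective n)
      have hfin : ∀ ij : Finset.HasAntidiagonal.antidiagonal n,
          Finite (avoiders ij.1.1 × avoiders ij.1.2) := by
        rintro ⟨⟨i, j⟩, h⟩
        have := Finset.HasAntidiagonal.mem_antidiagonal.1 h
        simp only at this
        have := (ih i (by omega)).1
        have := (ih j (by omega)).1
        exact inferInstance
      refine ⟨Finite.of_equiv _ e, ?_⟩
      rw [← Nat.card_congr e, Nat.card_sigma, catalan_succ',
        ← Finset.sum_coe_sort (Finset.HasAntidiagonal.antidiagonal n)]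
      refine Finset.sum_congr rfl ?_
      rintro ⟨⟨i, j⟩, h⟩ -
      have := Finset.HasAntidiagonal.mem_antidiagonal.1 h
      simp only at this
      rw [Nat.card_prod, (ih i (by omega)).2, (ih j (by omega)).2]

/-! ### Avoiders of order three and the insertion of a block -/

/-- The `132`-avoiding permutations `f` of `{0, …, n-1}` with `f³ = 1`, extended to `ℕ` by fixed
points. They are functions rather than permutations because `f³ = 1` already gives the inverse. -/
def cubicAvoiders (n : ℕ) : Set (ℕ → ℕ) :=
  {f | (∀ x, n ≤ x → f x = x) ∧ (∀ x, f (f (f x)) = x) ∧ Avoids132 f}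

/-- The number `k` is a gap of the permutation `f` of `{0, …, n-1}`: `f` maps the first `k` elements
onto the last `k` elements, where it is increasing. The condition `2 * k ≤ n` excludes the
identity, and `0` is always a gap. Gaps are the places where a new block may be inserted. -/
def IsGap (n : ℕ) (f : ℕ → ℕ) (k : ℕ) : Prop :=
  2 * k ≤ n ∧ (∀ x, x < n → (x < k ↔ n - k ≤ f x)) ∧
    ∀ x y, n - k ≤ x → x < y → y < n → f x < f y

open scoped Classical in
/-- The set of gaps. -/
noncomputable def gaps (n : ℕ) (f : ℕ → ℕ) : Finset ℕ := (Finset.range (n + 1)).filter (IsGap n f)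

theorem mem_gaps {n : ℕ} {f : ℕ → ℕ} {k : ℕ} : k ∈ gaps n f ↔ IsGap n f k := by
  simp only [gaps, Finset.mem_filter, Finset.mem_range, and_iff_right_iff_imp]
  intro h
  have := h.1
  omega

theorem injective_of_cube {f : ℕ → ℕ} (h : ∀ x, f (f (f x)) = x) : Function.Injective f := by
  intro x y hxy
  rw [← h x, hxy, h y]

theorem zero_isGap {n : ℕ} {f : ℕ → ℕ} (hf : f ∈ cubicAvoiders n) : IsGap n f 0 := by
  refine ⟨by omega, fun x hx => ?_, fun x y h1 h2 h3 => by omega⟩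
  have := lt_of_fixes_from (injective_of_cube hf.2.1) hf.1 hx
  omega

/-- The permutation of size `r + 3 * (l + 1)` obtained from a permutation `f` of size `r` and a
permutation `L` of size `l` as follows. Put `a = l + 1`. The new elements are `A`, the `a` lowest
ones, `B`, the `a` highest ones, and `C`, which is placed immediately below the `k` highest old
elements. Then `A` is mapped to `B` by `L` followed by a maximum, `B` to `C` by the increasing
bijection, and `C` to `A` such that the cube is the identity. -/
def insertBlock (l r k : ℕ) (L : Equiv.Perm ℕ) (f : ℕ → ℕ) (x : ℕ) : ℕ :=
  if x < l + 1 then L x + (r + 2 * (l + 1))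
  else if x < (l + 1) + (r - k) then
    if f (x - (l + 1)) < r - k then f (x - (l + 1)) + (l + 1) else f (x - (l + 1)) + 2 * (l + 1)
  else if x < 2 * (l + 1) + (r - k) then L.symm (x - ((l + 1) + (r - k)))
  else if x < 2 * (l + 1) + r then
    if f (x - 2 * (l + 1)) < r - k then f (x - 2 * (l + 1)) + (l + 1)
    else f (x - 2 * (l + 1)) + 2 * (l + 1)
  else if x < 3 * (l + 1) + r then x - (r + 2 * (l + 1)) + ((l + 1) + (r - k))
  else x

section insertBlock

variable {l r k : ℕ} {L : Equiv.Perm ℕ} {f : ℕ → ℕ}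

theorem insertBlock_bottom {x : ℕ} (hx : x < l + 1) :
    insertBlock l r k L f x = L x + (r + 2 * (l + 1)) := by
  rw [insertBlock, if_pos hx]

theorem insertBlock_low {x : ℕ} (hx : x < r - k) :
    insertBlock l r k L f (x + (l + 1)) =
      if f x < r - k then f x + (l + 1) else f x + 2 * (l + 1) := by
  rw [insertBlock, if_neg (by omega), if_pos (by omega), Nat.add_sub_cancel]

theorem insertBlock_middle {x : ℕ} (hx : x < l + 1) :
    insertBlock l r k L f (x + ((l + 1) + (r - k))) = L.symm x := by
  rw [insertBlock, if_neg (by omega), if_neg (by omega), if_pos (by omega), Nat.add_sub_cancel]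

theorem insertBlock_high {x : ℕ} (hx : r - k ≤ x) (hx' : x < r) :
    insertBlock l r k L f (x + 2 * (l + 1)) =
      if f x < r - k then f x + (l + 1) else f x + 2 * (l + 1) := by
  rw [insertBlock, if_neg (by omega), if_neg (by omega), if_neg (by omega), if_pos (by omega),
    Nat.add_sub_cancel]

theorem insertBlock_top {x : ℕ} (hx : x < l + 1) :
    insertBlock l r k L f (x + (r + 2 * (l + 1))) = x + ((l + 1) + (r - k)) := by
  rw [insertBlock, if_neg (by omega), if_neg (by omega), if_neg (by omega), if_neg (by omega),
    if_pos (by omega), Nat.add_sub_cancel]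

theorem insertBlock_beyond {x : ℕ} (hx : r + 3 * (l + 1) ≤ x) : insertBlock l r k L f x = x := by
  rw [insertBlock, if_neg (by omega), if_neg (by omega), if_neg (by omega), if_neg (by omega),
    if_neg (by omega)]

theorem insertBlock_zones (l r k x : ℕ) :
    x < l + 1 ∨ (∃ y, y < r - k ∧ x = y + (l + 1)) ∨
    (∃ y, y < l + 1 ∧ x = y + ((l + 1) + (r - k))) ∨
    (∃ y, r - k ≤ y ∧ y < r ∧ x = y + 2 * (l + 1)) ∨
    (∃ y, y < l + 1 ∧ x = y + (r + 2 * (l + 1))) ∨ r + 3 * (l + 1) ≤ x := by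
  by_cases h1 : x < l + 1
  · exact Or.inl h1
  by_cases h2 : x < (l + 1) + (r - k)
  · exact Or.inr (Or.inl ⟨x - (l + 1), by omega, by omega⟩)
  by_cases h3 : x < 2 * (l + 1) + (r - k)
  · exact Or.inr (Or.inr (Or.inl ⟨x - ((l + 1) + (r - k)), by omega, by omega⟩))
  by_cases h4 : x < 2 * (l + 1) + r
  · exact Or.inr (Or.inr (Or.inr (Or.inl ⟨x - 2 * (l + 1), by omega, by omega, by omega⟩)))
  by_cases h5 : x < 3 * (l + 1) + r
  · exact Or.inr (Or.inr (Or.inr (Or.inr (Or.inl ⟨x - (r + 2 * (l + 1)), by omega, by omega⟩))))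
  exact Or.inr (Or.inr (Or.inr (Or.inr (Or.inr (by omega)))))

theorem perm_block_lt (hL : L ∈ avoiders l) {x : ℕ} (hx : x < l + 1) : L x < l + 1 :=
  lt_of_fixes_from L.injective (fun y hy => hL.1 y (by omega)) hx

theorem perm_block_symm_lt (hL : L ∈ avoiders l) {x : ℕ} (hx : x < l + 1) : L.symm x < l + 1 :=
  lt_of_fixes_from L.symm.injective (fun y hy => symm_fixes_from hL.1 y (by omega)) hx

theorem insertBlock_cube (hL : L ∈ avoiders l) (hf : f ∈ cubicAvoiders r) (x : ℕ) :
    insertBlock l r k L f (insertBlock l r k L f (insertBlock l r k L f x)) = x := by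
  have hfl : ∀ y, y < r → f y < r := fun y hy =>
    lt_of_fixes_from (injective_of_cube hf.2.1) hf.1 hy
  have hold : ∀ y, y < r → insertBlock l r k L f
      (if y < r - k then y + (l + 1) else y + 2 * (l + 1)) =
      if f y < r - k then f y + (l + 1) else f y + 2 * (l + 1) := by
    intro y hy
    by_cases h : y < r - k
    · rw [if_pos h, insertBlock_low h]
    · rw [if_neg h, insertBlock_high (by omega) hy]
  rcases insertBlock_zones l r k x with h | ⟨y, h, rfl⟩ | ⟨y, h, rfl⟩ | ⟨y, h, h', rfl⟩ |
    ⟨y, h, rfl⟩ | h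
  · rw [insertBlock_bottom h, insertBlock_top (perm_block_lt hL h),
      insertBlock_middle (perm_block_lt hL h), Equiv.symm_apply_apply]
  · rw [insertBlock_low h, hold _ (hfl y (by omega)), hold _ (hfl _ (hfl y (by omega))), hf.2.1,
      if_pos h]
  · rw [insertBlock_middle h, insertBlock_bottom (perm_block_symm_lt hL h),
      Equiv.apply_symm_apply, insertBlock_top h]
  · rw [insertBlock_high h h', hold _ (hfl y (by omega)), hold _ (hfl _ (hfl y (by omega))),
      hf.2.1, if_neg (by omega)]
  · rw [insertBlock_top h, insertBlock_middle h, insertBlock_bottom (perm_block_symm_lt hL h),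
      Equiv.apply_symm_apply]
  · simp only [insertBlock_beyond h]

/-- The position and the value of each point of the new permutation. -/
theorem insertBlock_cases (hL : L ∈ avoiders l) (hf : f ∈ cubicAvoiders r) (x : ℕ) :
    (x < l + 1 ∧ L x < l + 1 ∧ insertBlock l r k L f x = L x + (r + 2 * (l + 1))) ∨
    (∃ y, y < r ∧ f y < r ∧ (y < r - k ∧ x = y + (l + 1) ∨ r - k ≤ y ∧ x = y + 2 * (l + 1)) ∧
      (f y < r - k ∧ insertBlock l r k L f x = f y + (l + 1) ∨
        r - k ≤ f y ∧ insertBlock l r k L f x = f y + 2 * (l + 1))) ∨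
    (∃ y, y < l + 1 ∧ L.symm y < l + 1 ∧ x = y + ((l + 1) + (r - k)) ∧
      insertBlock l r k L f x = L.symm y) ∨
    (∃ y, y < l + 1 ∧ x = y + (r + 2 * (l + 1)) ∧
      insertBlock l r k L f x = y + ((l + 1) + (r - k))) ∨
    (r + 3 * (l + 1) ≤ x ∧ insertBlock l r k L f x = x) := by
  have hfl : ∀ y, y < r → f y < r := fun y hy =>
    lt_of_fixes_from (injective_of_cube hf.2.1) hf.1 hy
  rcases insertBlock_zones l r k x with h | ⟨y, h, rfl⟩ | ⟨y, h, rfl⟩ | ⟨y, h, h', rfl⟩ |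
    ⟨y, h, rfl⟩ | h
  · exact Or.inl ⟨h, perm_block_lt hL h, insertBlock_bottom h⟩
  · refine Or.inr (Or.inl ⟨y, by omega, hfl y (by omega), Or.inl ⟨h, rfl⟩, ?_⟩)
    rw [insertBlock_low h]
    split_ifs <;> omega
  · exact Or.inr (Or.inr (Or.inl ⟨y, h, perm_block_symm_lt hL h, rfl, insertBlock_middle h⟩))
  · refine Or.inr (Or.inl ⟨y, h', hfl y h', Or.inr ⟨h, rfl⟩, ?_⟩)
    rw [insertBlock_high h h']
    split_ifs <;> omega
  · exact Or.inr (Or.inr (Or.inr (Or.inl ⟨y, h, rfl, insertBlock_top h⟩)))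
  · exact Or.inr (Or.inr (Or.inr (Or.inr ⟨h, insertBlock_beyond h⟩)))

/-- An occurrence of `132` in the new permutation would have to start in `A`, `B`, `C` or the old
part. In the first three cases the other two points lie in the same part or in a region where the
permutation increases; in the last case they are old, as the gap condition keeps the values of `B`
out of the way. -/
theorem insertBlock_avoids (hL : L ∈ avoiders l) (hf : f ∈ cubicAvoiders r) (hk : IsGap r f k) :
    Avoids132 (insertBlock l r k L f) := by
  obtain ⟨hk1, hk2, hk3⟩ := hk
  intro i j z hij hjz h1 h2
  have hi := insertBlock_cases (k := k) hL hf i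
  have hj := insertBlock_cases (k := k) hL hf j
  have hz := insertBlock_cases (k := k) hL hf z
  generalize insertBlock l r k L f i = Fi at *
  generalize insertBlock l r k L f j = Fj at *
  generalize insertBlock l r k L f z = Fz at *
  rcases hz with hz | ⟨c, hc, hfc, hz, hz'⟩ | ⟨c, hc, hLc, hz, hz'⟩ | ⟨c, hc, hz, hz'⟩ | hz
  · rcases hj with hj | ⟨b, hb, hfb, hj, hj'⟩ | ⟨b, hb, hLb, hj, hj'⟩ | ⟨b, hb, hj, hj'⟩ | hj <;>
      try omega
    rcases hi with hi | ⟨a, ha, hfa, hi, hi'⟩ | ⟨a, ha, hLa, hi, hi'⟩ | ⟨a, ha, hi, hi'⟩ | hi <;>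
      try omega
    exact hL.2 i j z hij hjz (by omega) (by omega)
  · have hkc := hk2 c hc
    rcases hi with hi | ⟨a, ha, hfa, hi, hi'⟩ | ⟨a, ha, hLa, hi, hi'⟩ | ⟨a, ha, hi, hi'⟩ | hi <;>
      try omega
    · rcases hj with hj | ⟨b, hb, hfb, hj, hj'⟩ | ⟨b, hb, hLb, hj, hj'⟩ | ⟨b, hb, hj, hj'⟩ | hj <;>
        try omega
      exact hf.2.2 a b c (by omega) (by omega) (by omega) (by omega)
    · rcases hj with hj | ⟨b, hb, hfb, hj, hj'⟩ | ⟨b, hb, hLb, hj, hj'⟩ | ⟨b, hb, hj, hj'⟩ | hj <;>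
        try omega
      have := hk3 b c (by omega) (by omega) hc
      omega
  · rcases hj with hj | ⟨b, hb, hfb, hj, hj'⟩ | ⟨b, hb, hLb, hj, hj'⟩ | ⟨b, hb, hj, hj'⟩ | hj <;>
      rcases hi with hi | ⟨a, ha, hfa, hi, hi'⟩ | ⟨a, ha, hLa, hi, hi'⟩ | ⟨a, ha, hi, hi'⟩ | hi <;>
      try omega
    exact hL.2.symm a b c (by omega) (by omega) (by omega) (by omega)
  · rcases hj with hj | ⟨b, hb, hfb, hj, hj'⟩ | ⟨b, hb, hLb, hj, hj'⟩ | ⟨b, hb, hj, hj'⟩ | hj <;>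
      rcases hi with hi | ⟨a, ha, hfa, hi, hi'⟩ | ⟨a, ha, hLa, hi, hi'⟩ | ⟨a, ha, hi, hi'⟩ | hi <;>
      try omega
    · have := hk2 b hb
      have := hk2 a ha
      omega
    · have := hk2 b hb
      omega
  · rcases hj with hj | ⟨b, hb, hfb, hj, hj'⟩ | ⟨b, hb, hLb, hj, hj'⟩ | ⟨b, hb, hj, hj'⟩ | hj <;>
      omega

theorem insertBlock_mem (hL : L ∈ avoiders l) (hf : f ∈ cubicAvoiders r) (hk : IsGap r f k) :
    insertBlock l r k L f ∈ cubicAvoiders (r + 3 * (l + 1)) :=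
  ⟨fun _ hx => insertBlock_beyond hx, insertBlock_cube hL hf, insertBlock_avoids hL hf hk⟩

theorem isGap_insertBlock_iff (hL : L ∈ avoiders l) (hf : f ∈ cubicAvoiders r) (hk : IsGap r f k)
    (K : ℕ) : IsGap (r + 3 * (l + 1)) (insertBlock l r k L f) K ↔
      K = 0 ∨ ∃ k' ≤ k, IsGap r f k' ∧ K = k' + (l + 1) := by
  have hfl : ∀ y, y < r → f y < r := fun y hy =>
    lt_of_fixes_from (injective_of_cube hf.2.1) hf.1 hy
  have hmem := insertBlock_mem hL hf hk
  obtain ⟨hk1, hk2, hk3⟩ := hk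
  constructor
  · rintro ⟨hK1, hK2, hK3⟩
    rcases Nat.eq_zero_or_pos K with rfl | hK
    · exact Or.inl rfl
    refine Or.inr ?_
    -- The set `A` contains the preimage `l` of the maximum, so `K` is at least its size.
    have hlK : l < K := by
      have := hK2 l (by omega)
      rw [insertBlock_bottom (by omega), hL.1 l le_rfl] at this
      omega
    -- The maximum is not among the first `K` elements, so its image, the top element of `C`, is not
    -- among the last `K` elements.
    have hKk : K ≤ k + (l + 1) := by
      have h1 := hK2 (l + (r + 2 * (l + 1))) (by omega)
      rw [insertBlock_top (by omega)] at h1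
      omega
    refine ⟨K - (l + 1), by omega, ⟨by omega, ?_, ?_⟩, by omega⟩
    · intro x hx
      have h1 := hk2 x hx
      have h2 := hfl x hx
      by_cases hxk : x < r - k
      · have h3 := hK2 (x + (l + 1)) (by omega)
        rw [insertBlock_low hxk] at h3
        split_ifs at h3 <;> omega
      · omega
    · intro x y h1 h2 h3
      exact hk3 x y (by omega) h2 h3
  · rintro (rfl | ⟨k', hkk, ⟨hg1, hg2, hg3⟩, rfl⟩)
    · exact zero_isGap hmem
    refine ⟨by omega, ?_, ?_⟩
    · intro x hx
      rcases insertBlock_zones l r k x with h | ⟨y, h, rfl⟩ | ⟨y, h, rfl⟩ | ⟨y, h, h', rfl⟩ |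
        ⟨y, h, rfl⟩ | h
      · rw [insertBlock_bottom h]; omega
      · have h1 := hg2 y (by omega)
        have h2 := hk2 y (by omega)
        rw [insertBlock_low h]
        split_ifs <;> omega
      · have := perm_block_symm_lt hL h
        rw [insertBlock_middle h]; omega
      · have h1 := hg2 y (by omega)
        have h2 := hk2 y (by omega)
        rw [insertBlock_high h h']
        split_ifs <;> omega
      · rw [insertBlock_top h]; omega
      · omega
    · intro x y h1 h2 h3
      rcases insertBlock_zones l r k x with h | ⟨x, h, rfl⟩ | ⟨x, h, rfl⟩ | ⟨x, h, h', rfl⟩ |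
        ⟨x, h, rfl⟩ | h <;> try omega
      all_goals
        rcases insertBlock_zones l r k y with hy | ⟨y, hy, rfl⟩ | ⟨y, hy, rfl⟩ | ⟨y, hy, hy', rfl⟩ |
          ⟨y, hy, rfl⟩ | hy <;> try omega
      · have h4 := hk2 x h'
        have h5 := hk2 y hy'
        have h6 := hg3 x y (by omega) (by omega) hy'
        rw [insertBlock_high h h', insertBlock_high hy hy', if_pos (by omega), if_pos (by omega)]
        omega
      · have h4 := hk2 x h'
        rw [insertBlock_high h h', insertBlock_top hy, if_pos (by omega)]
        omega
      · rw [insertBlock_top h, insertBlock_top hy]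
        omega

theorem card_gaps_insertBlock (hL : L ∈ avoiders l) (hf : f ∈ cubicAvoiders r)
    (hk : IsGap r f k) : (gaps (r + 3 * (l + 1)) (insertBlock l r k L f)).card =
      ((gaps r f).filter (· ≤ k)).card + 1 := by
  have : gaps (r + 3 * (l + 1)) (insertBlock l r k L f) =
      insert 0 (((gaps r f).filter (· ≤ k)).image (· + (l + 1))) := by
    ext K
    rw [mem_gaps, isGap_insertBlock_iff hL hf hk]
    simp only [Finset.mem_insert, Finset.mem_image, Finset.mem_filter, mem_gaps]
    constructor
    · rintro (h | ⟨k', h1, h2, rfl⟩)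
      · exact Or.inl h
      · exact Or.inr ⟨k', ⟨h2, h1⟩, rfl⟩
    · rintro (h | ⟨k', ⟨h2, h1⟩, rfl⟩)
      · exact Or.inl h
      · exact Or.inr ⟨k', h1, h2, rfl⟩
  rw [this, Finset.card_insert_of_notMem (by simp),
    Finset.card_image_of_injective _ (add_left_injective _)]

end insertBlock

/-! ### Removing the outermost block -/

theorem Avoids132.comp_self {f : ℕ → ℕ} (hf : ∀ x, f (f (f x)) = x) (h : Avoids132 f) :
    Avoids132 fun x => f (f x) := by
  intro i j k hij hjk h1 h2
  exact h _ _ _ h1 h2 (by simpa only [hf] using hij) (by simpa only [hf] using hjk)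

theorem comp_self_mem_cubicAvoiders {n : ℕ} {f : ℕ → ℕ} (hf : f ∈ cubicAvoiders n) :
    (fun x => f (f x)) ∈ cubicAvoiders n :=
  ⟨fun x hx => by simp only [hf.1 x hx], fun x => by simp only [hf.2.1],
    hf.2.2.comp_self hf.2.1⟩

/-- In the presence of a nonzero gap, the cycle of the maximum `N` is `p ↦ N ↦ q ↦ p` with
`p < q < N`. -/
theorem lt_and_lt_of_isGap {N k : ℕ} {f : ℕ → ℕ} (hf : f ∈ cubicAvoiders (N + 1))
    (hk : IsGap (N + 1) f k) (h0 : k ≠ 0) : f (f N) < f N ∧ f N < N := by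
  obtain ⟨h1, h2, h3⟩ := hk
  have hinj := injective_of_cube hf.2.1
  have hlt : ∀ x, x < N + 1 → f x < N + 1 := fun x hx => lt_of_fixes_from hinj hf.1 hx
  have hp := h2 (f (f N)) (hlt _ (hlt _ (by omega)))
  rw [hf.2.1] at hp
  have hq := h2 N (by omega)
  have hqp := h2 (f N) (hlt _ (by omega))
  have hne : f (f N) ≠ f N := fun h => by
    have := hinj h
    omega
  omega

/-- The position of the block `C` that is cut out of `f`: if `p ↦ N ↦ q ↦ p` is the cycle of the
maximum and `p < q < N`, the `p + 1` highest elements are mapped increasingly onto the interval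
that ends in `q`. -/
theorem top_block_image {N p q : ℕ} {f : ℕ → ℕ} (hf : f ∈ cubicAvoiders (N + 1)) (hp : f p = N)
    (hN : f N = q) (hq : f q = p) (hpq : p < q)
    (H1 : ∀ x, x ≤ N → (x ≤ p ↔ N - p ≤ f x)) (hpqN : p + q < N) :
    ∀ j, j ≤ p → f (N - j) + j = q := by
  obtain ⟨hfix, hcube, hav⟩ := hf
  have hinj := injective_of_cube hcube
  have hlt : ∀ x, x ≤ N → f x ≤ N := fun x hx =>
    Nat.lt_succ_iff.1 (lt_of_fixes_from hinj hfix (Nat.lt_succ_of_le hx))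
  -- The elements of `B` are mapped to `A` by `f²`.
  have hB : ∀ b, N - p ≤ b → b ≤ N → f (f b) ≤ p := fun b h1 h2 => by
    have := H1 (f (f b)) (hlt _ (hlt _ h2))
    rw [hcube] at this
    omega
  have hBp : ∀ b, N - p ≤ b → b ≤ N → p < f b := fun b h1 h2 => by
    have := H1 (f b) (hlt _ h2)
    have := hB b h1 h2
    omega
  have hinc : ∀ b b', N - p ≤ b → b < b' → b' ≤ N → f b < f b' := fun b b' h1 h2 h3 => by
    have h4 := hBp b' (by omega) h3
    have h5 : f b ≠ f b' := fun h => by have := hinj h; omega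
    by_contra hc
    exact hav q b b' (by omega) h2 (by omega) (by omega)
  intro j
  induction j with
  | zero => intro _; simpa using hN
  | succ j ih =>
    intro hj
    have ihj := ih (by omega)
    have h1 := hinc (N - (j + 1)) (N - j) (by omega) (by omega) (by omega)
    by_contra hc
    -- Otherwise `x = q - j - 1` lies between two images of `B`, and `f (f b), f x, p` form the
    -- pattern `132` at the positions `f b, x, q`, where `b = N - (j + 1)`.
    obtain ⟨x, hx⟩ : ∃ x, x + (j + 1) = q := ⟨q - (j + 1), by omega⟩
    have hy : f (f x) < N - p := by
      by_contra hy
      have hyN := hlt _ (hlt x (by omega))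
      rcases lt_trichotomy (f (f x)) (N - (j + 1)) with h | h | h
      · have := hinc _ _ (by omega) h (by omega)
        rw [hcube] at this
        omega
      · have := hcube x
        rw [h] at this
        omega
      · rcases Nat.lt_or_ge (N - j) (f (f x)) with h' | h'
        · have := hinc _ _ (by omega) h' (by omega)
          rw [hcube] at this
          omega
        · have : f (f x) = N - j := by omega
          have h3 := hcube x
          rw [this] at h3
          omega
    have hw := H1 (f x) (hlt x (by omega))
    have ha := hB (N - (j + 1)) (by omega) (by omega)
    have hne : f (f (N - (j + 1))) ≠ p := fun h => by
      have := hcube (N - (j + 1))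
      rw [h] at this
      omega
    exact hav (f (N - (j + 1))) x q (by omega) (by omega) (by omega) (by omega)

/-- A permutation in which the cycle `p ↦ N ↦ q ↦ p` of the maximum satisfies `p < q < N` arises by
the insertion of a block. -/
theorem exists_eq_insertBlock {N p q : ℕ} {f : ℕ → ℕ} (hf : f ∈ cubicAvoiders (N + 1))
    (hp : f p = N) (hN : f N = q) (hq : f q = p) (hpq : p < q) (hqN : q < N) :
    ∃ l r k L f', r + 3 * (l + 1) = N + 1 ∧ L ∈ avoiders l ∧ f' ∈ cubicAvoiders r ∧
      IsGap r f' k ∧ f = insertBlock l r k L f' := by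
  have hf0 := hf
  obtain ⟨hfix, hcube, hav⟩ := hf
  have hinj := injective_of_cube hcube
  have hlt : ∀ x, x ≤ N → f x ≤ N := fun x hx =>
    Nat.lt_succ_iff.1 (lt_of_fixes_from hinj hfix (Nat.lt_succ_of_le hx))
  have H1 : ∀ x, x ≤ N → (x ≤ p ↔ N - p ≤ f x) := fun x hx =>
    lt_iff_of_maximum hinj hfix (by omega) hp hav hx
  have H2 : ∀ y, y ≤ N → (f y ≤ q ↔ N - q ≤ y) := fun y hy => by
    have := lt_iff_of_maximum (f := fun x => f (f x)) (n := N) (p := q)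
      (hinj.comp hinj) (fun x hx => by simp only [hfix x hx]) (by omega) (by simp only [hq, hp])
      (hav.comp_self hcube) (hlt y hy)
    rwa [hcube] at this
  have hpqN : p + q < N := by
    have := H2 p (by omega)
    omega
  have HC := top_block_image hf0 hp hN hq hpq H1 hpqN
  have hB : ∀ b, N - p ≤ b → b ≤ N → f (f b) ≤ p := fun b h1 h2 => by
    have := H1 (f (f b)) (hlt _ (hlt _ h2))
    rw [hcube] at this
    omega
  have hCtop := HC p le_rfl
  have hCp : p < f (N - p) := by
    have := H1 (f (N - p)) (hlt _ (by omega))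
    have := hB (N - p) (by omega) (by omega)
    omega
  have h2q : N + p ≤ 2 * q := by
    have := H2 (f (N - p)) (hlt _ (by omega))
    have := hB (N - p) (by omega) (by omega)
    omega
  obtain ⟨r, hr⟩ : ∃ r, r + 3 * (p + 1) = N + 1 := ⟨N + 1 - 3 * (p + 1), by omega⟩
  obtain ⟨k, hk⟩ : ∃ k, k + (p + 1 + q) = N := ⟨N - (p + 1 + q), by omega⟩
  have hg : r - k + (2 * p + 1) = q := by omega
  -- The remaining elements are permuted among themselves.
  have hold : ∀ y, p < y → y < N - p → (y < q - p ∨ q < y) →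
      p < f y ∧ f y < N - p ∧ (f y < q - p ∨ q < f y) := by
    intro y h1 h2 h3
    have h4 := H1 y (by omega)
    have hne : ∀ j, j ≤ p → f y + j ≠ q := fun j hj h => by
      have h5 : f y = f (N - j) := by have := HC j hj; omega
      have := hinj h5
      omega
    have hpy : p < f y := by
      by_contra hc
      have h5 := H1 (f y) (hlt _ (by omega))
      have h6 := HC (N - f (f y)) (by omega)
      have h7 := hlt _ (hlt y (by omega))
      rw [show N - (N - f (f y)) = f (f y) by omega, hcube] at h6
      omega
    refine ⟨hpy, by omega, ?_⟩
    by_contra hc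
    exact hne (q - f y) (by omega) (by omega)
  let L : Equiv.Perm ℕ :=
    { toFun := fun x => if x < p + 1 then f x - (N - p) else x
      invFun := fun y => if y < p + 1 then f (f (y + (N - p))) else y
      left_inv := by
        intro x
        by_cases hx : x < p + 1
        · have h1 := (H1 x (by omega)).1 (by omega)
          have h2 := hlt x (by omega)
          have h4 : f x - (N - p) < p + 1 := by omega
          have h5 : f x - (N - p) + (N - p) = f x := by omega
          simp only [hx, h4, h5, if_true, hcube]
        · simp [hx]
      right_inv := by
        intro y
        by_cases hy : y < p + 1
        · have h1 := hB (y + (N - p)) (by omega) (by omega)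
          have h4 : f (f (y + (N - p))) < p + 1 := by omega
          simp only [hy, h4, if_true, hcube, Nat.add_sub_cancel]
        · simp [hy] }
  have hLa : ∀ x, L x = if x < p + 1 then f x - (N - p) else x := fun _ => rfl
  have hLs : ∀ y, L.symm y = if y < p + 1 then f (f (y + (N - p))) else y := fun _ => rfl
  have hL : L ∈ avoiders p := by
    refine ⟨fun x hx => ?_, ?_⟩
    · rw [hLa]
      split_ifs with h
      · rw [show x = p by omega, hp]; omega
      · rfl
    · intro i j z hij hjz h1 h2
      rw [hLa, hLa] at h1 h2
      have := H1 i; have := H1 j; have := H1 z; have := hlt j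
      split_ifs at h1 h2 <;> first | omega | exact hav i j z hij hjz (by omega) (by omega)
  -- The order embedding of the remaining elements, and its inverse.
  let e : ℕ → ℕ := fun x => if x < r - k then x + (p + 1) else x + 2 * (p + 1)
  let d : ℕ → ℕ := fun y => if y < q - p then y - (p + 1) else y - 2 * (p + 1)
  have he : ∀ x, (x < r - k ∧ e x = x + (p + 1)) ∨ (r - k ≤ x ∧ e x = x + 2 * (p + 1)) := by
    intro x
    simp only [e]
    split_ifs <;> omega
  have hd : ∀ y, (y < q - p ∧ d y = y - (p + 1)) ∨ (q - p ≤ y ∧ d y = y - 2 * (p + 1)) := by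
    intro y
    simp only [d]
    split_ifs <;> omega
  have heinj : Function.Injective e := fun x y h => by
    have := he x; have := he y; omega
  let f' : ℕ → ℕ := fun x => if x < r then d (f (e x)) else x
  have hf'old : ∀ x, x < r → p < f (e x) ∧ f (e x) < N - p ∧ (f (e x) < q - p ∨ q < f (e x)) := by
    intro x hx
    have := he x
    exact hold (e x) (by omega) (by omega) (by omega)
  have hf'a : ∀ x, x < r → f' x < r ∧ e (f' x) = f (e x) := by
    intro x hx
    have h1 := hf'old x hx
    have h2 := hd (f (e x))
    have h3 := he (f' x)
    have h4 : f' x = d (f (e x)) := if_pos hx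
    omega
  have hf'fix : ∀ x, r ≤ x → f' x = x := fun x hx => if_neg (by omega)
  have hf'mem : f' ∈ cubicAvoiders r := by
    refine ⟨hf'fix, fun x => ?_, ?_⟩
    · by_cases hx : x < r
      · apply heinj
        obtain ⟨h1, h2⟩ := hf'a x hx
        obtain ⟨h3, h4⟩ := hf'a _ h1
        rw [(hf'a _ h3).2, h4, h2, hcube]
      · simp only [hf'fix x (by omega)]
    · intro i j z hij hjz h1 h2
      by_cases hz : z < r
      · have hi := hf'a i (by omega)
        have hj := hf'a j (by omega)
        have hz := hf'a z (by omega)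
        have := he i; have := he j; have := he z
        have := he (f' i); have := he (f' j); have := he (f' z)
        exact hav (e i) (e j) (e z) (by omega) (by omega) (by omega) (by omega)
      · have := hf'fix z (by omega)
        by_cases hj : j < r
        · have := hf'a j hj
          omega
        · have := hf'fix j (by omega)
          omega
  have hgap : IsGap r f' k := by
    refine ⟨by omega, fun x hx => ?_, fun x y h1 h2 h3 => ?_⟩
    · have h1 := hf'a x hx
      have h2 := he x
      have h3 := he (f' x)
      have h4 := H2 (e x) (by omega)
      have h5 := hf'old x hx
      omega
    · have hx := hf'a x (by omega)
      have hy := hf'a y h3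
      have h4 := he x
      have h5 := he y
      have h6 := he (f' x)
      have h7 := he (f' y)
      have h8 := hf'old y h3
      have h9 : f (e x) ≠ f (e y) := fun h => by have := heinj (hinj h); omega
      by_contra hc
      -- The element `q`, whose image `p` is small, would complete a pattern `132`.
      exact hav q (e x) (e y) (by omega) (by omega) (by omega) (by omega)
  refine ⟨p, r, k, L, f', hr, hL, hf'mem, hgap, ?_⟩
  funext x
  rcases insertBlock_zones p r k x with h | ⟨y, h, rfl⟩ | ⟨y, h, rfl⟩ | ⟨y, h, h', rfl⟩ |
    ⟨y, h, rfl⟩ | h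
  · rw [insertBlock_bottom h, hLa, if_pos h]
    have := H1 x (by omega)
    omega
  · rw [insertBlock_low h]
    have h1 : e y = y + (p + 1) := if_pos h
    rw [← h1, ← (hf'a y (by omega)).2]
  · rw [insertBlock_middle h, hLs, if_pos h]
    have := HC (p - y) (by omega)
    rw [show y + (N - p) = N - (p - y) by omega,
      show f (N - (p - y)) = y + ((p + 1) + (r - k)) by omega]
  · rw [insertBlock_high h h']
    have h1 : e y = y + 2 * (p + 1) := if_neg (by omega)
    rw [← h1, ← (hf'a y (by omega)).2]
  · rw [insertBlock_top h]
    have := HC (p - y) (by omega)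
    rw [show y + (r + 2 * (p + 1)) = N - (p - y) by omega]
    omega
  · rw [insertBlock_beyond h, hfix x (by omega)]

/-- The inserted block can be recovered from the result. -/
theorem insertBlock_injective {l r k l' r' k' : ℕ} {L L' : Equiv.Perm ℕ} {f f' : ℕ → ℕ}
    (hL : L ∈ avoiders l) (hL' : L' ∈ avoiders l') (hf : f ∈ cubicAvoiders r)
    (hf' : f' ∈ cubicAvoiders r') (hk : IsGap r f k) (hk' : IsGap r' f' k')
    (hr : r + 3 * (l + 1) = r' + 3 * (l' + 1))
    (h : insertBlock l r k L f = insertBlock l' r' k' L' f') :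
    l = l' ∧ r = r' ∧ k = k' ∧ L = L' ∧ f = f' := by
  have hinj := injective_of_cube (insertBlock_mem hL hf hk).2.1
  have hk0 := hk.1
  have hk0' := hk'.1
  have hl : l = l' := by
    have h1 : insertBlock l r k L f l = l + (r + 2 * (l + 1)) := by
      rw [insertBlock_bottom (by omega), hL.1 l le_rfl]
    have h2 : insertBlock l r k L f l' = l' + (r' + 2 * (l' + 1)) := by
      rw [h, insertBlock_bottom (by omega), hL'.1 l' le_rfl]
    apply hinj
    rw [h1, h2]
    omega
  subst hl
  have hrr : r = r' := by omega
  subst hrr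
  have hkk : k = k' := by
    have h1 := insertBlock_top (l := l) (r := r) (k := k) (L := L) (f := f) (x := l) (by omega)
    rw [h, insertBlock_top (by omega)] at h1
    omega
  subst hkk
  refine ⟨rfl, rfl, rfl, ?_, ?_⟩
  · ext x
    by_cases hx : x < l + 1
    · have h1 := congrFun h x
      rw [insertBlock_bottom hx, insertBlock_bottom hx] at h1
      omega
    · rw [hL.1 x (by omega), hL'.1 x (by omega)]
  · funext x
    by_cases hx : x < r
    · by_cases hx' : x < r - k
      · have h1 := congrFun h (x + (l + 1))
        rw [insertBlock_low hx', insertBlock_low hx'] at h1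
        split_ifs at h1 <;> omega
      · have h1 := congrFun h (x + 2 * (l + 1))
        rw [insertBlock_high (by omega) hx, insertBlock_high (by omega) hx] at h1
        split_ifs at h1 <;> omega
    · rw [hf.1 x (by omega), hf'.1 x (by omega)]

/-! ### Counting by the number of gaps -/

theorem finite_cubicAvoiders (n : ℕ) : Finite (cubicAvoiders n) := by
  refine Finite.of_injective
    (fun (f : cubicAvoiders n) (x : Fin n) =>
      (⟨f.1 x, lt_of_fixes_from (injective_of_cube f.2.2.1) f.2.1 x.2⟩ : Fin n)) ?_
  intro f g h
  apply Subtype.ext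
  funext x
  by_cases hx : x < n
  · simpa using congrFun h ⟨x, hx⟩
  · rw [f.2.1 x (by omega), g.2.1 x (by omega)]

/-- The number of avoiders of order three with at least `i` gaps, the gap `0` included. -/
noncomputable def numWithGaps (i n : ℕ) : ℕ :=
  Nat.card {f // f ∈ cubicAvoiders n ∧ i ≤ (gaps n f).card}

instance (n : ℕ) (P : (ℕ → ℕ) → Prop) : Finite {f // f ∈ cubicAvoiders n ∧ P f} := by
  have := finite_cubicAvoiders n
  exact ((cubicAvoiders n).toFinite.subset fun f hf => hf.1).to_subtype

theorem zero_mem_gaps {n : ℕ} {f : ℕ → ℕ} (hf : f ∈ cubicAvoiders n) : 0 ∈ gaps n f :=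
  mem_gaps.2 (zero_isGap hf)

theorem one_le_card_gaps {n : ℕ} {f : ℕ → ℕ} (hf : f ∈ cubicAvoiders n) :
    1 ≤ (gaps n f).card := Finset.card_pos.2 ⟨0, zero_mem_gaps hf⟩

theorem numWithGaps_one (n : ℕ) : numWithGaps 1 n = Nat.card (cubicAvoiders n) :=
  Nat.card_congr (Equiv.subtypeEquivRight fun _ => ⟨fun h => h.1, fun h => ⟨h, one_le_card_gaps h⟩⟩)

theorem numWithGaps_eq_zero {i n : ℕ} (h : n + 1 < i) : numWithGaps i n = 0 := by
  have : IsEmpty {f // f ∈ cubicAvoiders n ∧ i ≤ (gaps n f).card} := by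
    refine ⟨fun f => ?_⟩
    have h1 : (gaps n f.1).card ≤ (Finset.range (n + 1)).card :=
      Finset.card_le_card fun k hk => Finset.mem_range.2 (by have := (mem_gaps.1 hk).1; omega)
    have := f.2.2
    rw [Finset.card_range] at h1
    omega
  exact Nat.card_of_isEmpty

theorem numWithGaps_succ (i n : ℕ) : numWithGaps i n =
    numWithGaps (i + 1) n + Nat.card {f // f ∈ cubicAvoiders n ∧ (gaps n f).card = i} := by
  have e : {f // f ∈ cubicAvoiders n ∧ i ≤ (gaps n f).card} ≃
      {f // (f ∈ cubicAvoiders n ∧ i + 1 ≤ (gaps n f).card) ∨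
        (f ∈ cubicAvoiders n ∧ (gaps n f).card = i)} :=
    Equiv.subtypeEquivRight fun f => by
      rw [← and_or_left]
      exact and_congr_right fun _ => by omega
  rw [numWithGaps, Nat.card_congr e, numWithGaps]
  classical
  have hd : Disjoint (fun f => f ∈ cubicAvoiders n ∧ i + 1 ≤ (gaps n f).card)
      (fun f => f ∈ cubicAvoiders n ∧ (gaps n f).card = i) :=
    Pi.disjoint_iff.2 fun f => Prop.disjoint_iff.2 (by rintro ⟨⟨_, h1⟩, _, h2⟩; omega)
  rw [Nat.card_congr (subtypeOrEquiv _ _ hd), Nat.card_sum]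

/-- A finite set of natural numbers has an element of each rank `i`, counted from `1`. -/
theorem exists_card_filter_le (s : Finset ℕ) {i : ℕ} (hi : 1 ≤ i) (h : i ≤ s.card) :
    ∃ k ∈ s, (s.filter (· ≤ k)).card = i := by
  have hP : ∀ hf : (Set.ofPred (· ∈ s)).Finite, i - 1 < hf.toFinset.card := fun hf => by
    have : hf.toFinset = s := by ext; simp
    rw [this]; omega
  refine ⟨Nat.nth (· ∈ s) (i - 1), Nat.nth_mem _ hP, ?_⟩
  have h1 := Nat.count_nth hP
  have h2 : (s.filter (· ≤ Nat.nth (· ∈ s) (i - 1))) =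
      (Finset.range (Nat.nth (· ∈ s) (i - 1) + 1)).filter (· ∈ s) := by
    ext x
    simp [and_comm]
  rw [h2, ← Nat.count_eq_card_filter_range, Nat.count_succ, h1, if_pos (Nat.nth_mem _ hP)]
  omega

theorem eq_of_card_filter_le {s : Finset ℕ} {k k' : ℕ} (hk : k ∈ s) (hk' : k' ∈ s)
    (h : (s.filter (· ≤ k)).card = (s.filter (· ≤ k')).card) : k = k' := by
  have key : ∀ a b : ℕ, b ∈ s → a < b → (s.filter (· ≤ a)).card < (s.filter (· ≤ b)).card := by
    intro a b hb hab
    refine Finset.card_lt_card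
      ((Finset.ssubset_iff_of_subset ?_).2 ⟨b, by simp [hb], by simp; omega⟩)
    intro x
    simp only [Finset.mem_filter]
    exact fun hx => ⟨hx.1, by omega⟩
  rcases lt_trichotomy k k' with hlt | heq | hlt
  · have := key k k' hk' hlt; omega
  · exact heq
  · have := key k' k hk hlt; omega

/-- The pairs of a number `l` and an avoider of size `l` that describe a block with `a` elements in
total, that is, with `a = 3 * (l + 1)`. -/
def blocks (a : ℕ) : Set (ℕ × Equiv.Perm ℕ) := {t | t.2 ∈ avoiders t.1 ∧ a = 3 * (t.1 + 1)}

/-- The equivalence between the blocks with `3 * (l + 1)` elements and the avoiders of size `l`. -/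
def blocksEquiv (l : ℕ) : blocks (3 * (l + 1)) ≃ avoiders l where
  toFun t := ⟨t.1.2, by have := t.2.1; rwa [show t.1.1 = l by have := t.2.2; omega] at this⟩
  invFun L := ⟨(l, L.1), L.2, rfl⟩
  left_inv t := Subtype.ext (Prod.ext (by have := t.2.2; simp only; omega) rfl)
  right_inv L := rfl

theorem finite_and_card_blocks (a : ℕ) : Finite (blocks a) ∧
    Nat.card (blocks a) = if 3 ∣ a ∧ a ≠ 0 then catalan (a / 3 - 1) else 0 := by
  split_ifs with h
  · obtain ⟨l, rfl⟩ : ∃ l, a = 3 * (l + 1) := ⟨a / 3 - 1, by omega⟩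
    have := (finite_and_card_avoiders l).1
    refine ⟨Finite.of_equiv _ (blocksEquiv l).symm, ?_⟩
    rw [Nat.card_congr (blocksEquiv l), (finite_and_card_avoiders l).2,
      show 3 * (l + 1) / 3 - 1 = l by omega]
  · have : IsEmpty (blocks a) := ⟨fun t => h (by have := t.2.2; omega)⟩
    exact ⟨inferInstance, Nat.card_of_isEmpty⟩

/-- Inserting a block at the gap of rank `i` yields a permutation with `i + 1` gaps. -/
noncomputable def insertBlockAtRank {i n : ℕ} (hi : 1 ≤ i)
    (t : Σ p : Finset.HasAntidiagonal.antidiagonal n, blocks p.1.1 ×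
      {f // f ∈ cubicAvoiders p.1.2 ∧ i ≤ (gaps p.1.2 f).card}) :
    {f // f ∈ cubicAvoiders n ∧ (gaps n f).card = i + 1} :=
  ⟨insertBlock t.2.1.1.1 t.1.1.2 (exists_card_filter_le _ hi t.2.2.2.2).choose t.2.1.1.2 t.2.2.1, by
    have hk := (exists_card_filter_le _ hi t.2.2.2.2).choose_spec
    have hn : t.1.1.2 + 3 * (t.2.1.1.1 + 1) = n := by
      have := Finset.HasAntidiagonal.mem_antidiagonal.1 t.1.2
      have := t.2.1.2.2
      omega
    have hm := insertBlock_mem t.2.1.2.1 t.2.2.2.1 (mem_gaps.1 hk.1)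
    have hc := card_gaps_insertBlock t.2.1.2.1 t.2.2.2.1 (mem_gaps.1 hk.1)
    rw [hn] at hm hc
    exact ⟨hm, by rw [hc, hk.2]⟩⟩

theorem insertBlockAtRank_bijective {i n : ℕ} (hi : 1 ≤ i) :
    Function.Bijective (insertBlockAtRank (n := n) hi) := by
  constructor
  · rintro ⟨⟨⟨a, r⟩, h⟩, ⟨⟨l, L⟩, hL, ha⟩, f, hf, hfi⟩
      ⟨⟨⟨a', r'⟩, h'⟩, ⟨⟨l', L'⟩, hL', ha'⟩, f', hf', hfi'⟩ he
    have hn := Finset.HasAntidiagonal.mem_antidiagonal.1 h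
    have hn' := Finset.HasAntidiagonal.mem_antidiagonal.1 h'
    simp only at hn hn' ha ha' hL hL' hf hf' hfi hfi'
    have hk := (exists_card_filter_le _ hi hfi).choose_spec
    have hk' := (exists_card_filter_le _ hi hfi').choose_spec
    obtain ⟨rfl, rfl, -, rfl, rfl⟩ := insertBlock_injective hL hL' hf hf' (mem_gaps.1 hk.1)
      (mem_gaps.1 hk'.1) (by omega) (congrArg Subtype.val he)
    obtain rfl : a = a' := by omega
    rfl
  · rintro ⟨f, hf, hc⟩
    obtain ⟨k, hk, hk0⟩ : ∃ k ∈ gaps n f, k ≠ 0 :=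
      Finset.exists_mem_ne (by omega) 0
    have hgap := mem_gaps.1 hk
    obtain ⟨N, rfl⟩ : ∃ N, n = N + 1 := ⟨n - 1, by have := hgap.1; omega⟩
    obtain ⟨h1, h2⟩ := lt_and_lt_of_isGap hf hgap hk0
    obtain ⟨l, r, k', L, f', hr, hL, hf', hk', rfl⟩ :=
      exists_eq_insertBlock hf (hf.2.1 N) rfl rfl h1 h2
    have hcard := card_gaps_insertBlock hL hf' hk'
    rw [hr, hc] at hcard
    have hle : i ≤ (gaps r f').card := by
      have := Finset.card_filter_le (gaps r f') (· ≤ k')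
      omega
    refine ⟨⟨⟨(3 * (l + 1), r), Finset.HasAntidiagonal.mem_antidiagonal.2 (by simp only; omega)⟩,
      ⟨(l, L), hL, rfl⟩, f', hf', hle⟩, ?_⟩
    apply Subtype.ext
    have hspec := (exists_card_filter_le _ hi hle).choose_spec
    have hkk : (exists_card_filter_le _ hi hle).choose = k' :=
      eq_of_card_filter_le hspec.1 (mem_gaps.2 hk') (by omega)
    change insertBlock l r (exists_card_filter_le _ hi hle).choose L f' = _
    rw [hkk]

theorem card_gaps_eq (i n : ℕ) (hi : 1 ≤ i) :
    Nat.card {f // f ∈ cubicAvoiders n ∧ (gaps n f).card = i + 1} =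
      ∑ p ∈ Finset.HasAntidiagonal.antidiagonal n,
        Nat.card (blocks p.1) * numWithGaps i p.2 := by
  have := fun a => (finite_and_card_blocks a).1
  rw [← Nat.card_congr (Equiv.ofBijective _ (insertBlockAtRank_bijective (n := n) hi)),
    Nat.card_sigma, ← Finset.sum_coe_sort (Finset.HasAntidiagonal.antidiagonal n)]
  exact Finset.sum_congr rfl fun p _ => Nat.card_prod _ _

/-- A nonzero gap exists exactly if the cycle of the maximum `N` is `p ↦ N ↦ q ↦ p` with
`p < q < N`. -/
theorem two_le_card_gaps_iff {N : ℕ} {f : ℕ → ℕ} (hf : f ∈ cubicAvoiders (N + 1)) :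
    2 ≤ (gaps (N + 1) f).card ↔ f (f N) < f N ∧ f N < N := by
  constructor
  · intro h
    obtain ⟨k, hk, hk0⟩ : ∃ k ∈ gaps (N + 1) f, k ≠ 0 := Finset.exists_mem_ne (by omega) 0
    exact lt_and_lt_of_isGap hf (mem_gaps.1 hk) hk0
  · rintro ⟨h1, h2⟩
    obtain ⟨l, r, k', L, f', hr, hL, hf', hk', rfl⟩ :=
      exists_eq_insertBlock hf (hf.2.1 N) rfl rfl h1 h2
    rw [← hr, card_gaps_insertBlock hL hf' hk']
    have : 0 < ((gaps r f').filter (· ≤ k')).card :=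
      Finset.card_pos.2 ⟨k', Finset.mem_filter.2 ⟨mem_gaps.2 hk', le_rfl⟩⟩
    omega

/-- The maximum is a fixed point, or its cycle has one of two shapes, which are exchanged by
`f ↦ f²`. -/
theorem card_cubicAvoiders_succ (N : ℕ) : Nat.card (cubicAvoiders (N + 1)) =
    Nat.card (cubicAvoiders N) + 2 * numWithGaps 2 (N + 1) := by
  have hfin := finite_cubicAvoiders (N + 1)
  let S := cubicAvoiders (N + 1)
  let S1 : Set (ℕ → ℕ) := {f | f ∈ S ∧ (f (f N) < f N ∧ f N < N)}
  let S2 : Set (ℕ → ℕ) := {f | f ∈ S ∧ (f N < f (f N) ∧ f (f N) < N)}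
  have hS : S = cubicAvoiders N ∪ (S1 ∪ S2) := by
    ext f
    constructor
    · intro hf
      have hinj := injective_of_cube hf.2.1
      have hlt : ∀ x, x < N + 1 → f x < N + 1 := fun x hx => lt_of_fixes_from hinj hf.1 hx
      by_cases h : f N = N
      · refine Or.inl ⟨fun x hx => ?_, hf.2⟩
        rcases Nat.lt_or_ge N x with h' | h'
        · exact hf.1 x h'
        · rwa [show x = N by omega]
      · right
        have h1 := hlt N (by omega)
        have h2 := hlt _ h1
        have h3 : f (f N) ≠ f N := fun h' => h (hinj h')
        have h4 : f (f N) ≠ N := fun h' => by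
          have := hf.2.1 N
          rw [h'] at this
          exact h this
        rcases lt_or_gt_of_ne h3 with h5 | h5
        · exact Or.inl ⟨hf, h5, by omega⟩
        · exact Or.inr ⟨hf, h5, by omega⟩
    · rintro (hf | hf | hf)
      · exact ⟨fun x hx => hf.1 x (by omega), hf.2⟩
      · exact hf.1
      · exact hf.1
  have hS12 : Nat.card S2 = Nat.card S1 := by
    refine Nat.card_congr
      { toFun := fun f => ⟨fun x => f.1 (f.1 x), comp_self_mem_cubicAvoiders f.2.1, ?_⟩
        invFun := fun f => ⟨fun x => f.1 (f.1 x), comp_self_mem_cubicAvoiders f.2.1, ?_⟩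
        left_inv := fun f => Subtype.ext (funext fun x => ?_)
        right_inv := fun f => Subtype.ext (funext fun x => ?_) }
    · have := f.2.2
      have hc := f.2.1.2.1
      simpa only [hc] using this
    · have := f.2.2
      have hc := f.2.1.2.1
      simpa only [hc] using this
    · have hc := f.2.1.2.1
      simp only [hc]
    · have hc := f.2.1.2.1
      simp only [hc]
  have h1 : Nat.card S1 = numWithGaps 2 (N + 1) :=
    Nat.card_congr (Equiv.subtypeEquivRight fun f =>
      and_congr_right fun hf => (two_le_card_gaps_iff hf).symm)
  have hf1 : S1.Finite := S.toFinite.subset fun f hf => hf.1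
  have hf2 : S2.Finite := S.toFinite.subset fun f hf => hf.1
  have hf0 : (cubicAvoiders N).Finite := @Set.toFinite _ _ (finite_cubicAvoiders N)
  have hd : Disjoint S1 S2 := Set.disjoint_left.2 fun f h h' => by
    have := h.2; have := h'.2; omega
  have hd0 : Disjoint (cubicAvoiders N) (S1 ∪ S2) := Set.disjoint_left.2 fun f h h' => by
    have h0 := h.1 N le_rfl
    rcases h' with h' | h'
    · have := h'.2; omega
    · have := h'.2; rw [h0] at this; omega
  change Nat.card S = _
  rw [hS, Nat.card_coe_set_eq, Set.ncard_union_eq hd0 hf0 (hf1.union hf2),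
    Set.ncard_union_eq hd hf1 hf2, ← Nat.card_coe_set_eq, ← Nat.card_coe_set_eq,
    ← Nat.card_coe_set_eq, hS12, h1]
  ring

theorem card_cubicAvoiders_zero : Nat.card (cubicAvoiders 0) = 1 := by
  have : cubicAvoiders 0 = {id} := by
    ext f
    constructor
    · intro h; exact funext fun x => h.1 x (Nat.zero_le x)
    · rintro rfl
      refine ⟨fun _ _ => rfl, fun _ => rfl, fun i j k h1 h2 h3 h4 => ?_⟩
      simp only [id] at h3 h4
      omega
  rw [this]
  simp

theorem numWithGaps_two_zero : numWithGaps 2 0 = 0 := numWithGaps_eq_zero (by omega)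

/-! ### Permutations of `Fin n` -/

theorem hasCycleLengthsIn_one_three_iff {n : ℕ} (π : Equiv.Perm (Fin n)) :
    HasCycleLengthsIn {1, 3} π ↔ ∀ x, π (π (π x)) = x := by
  have h1 : (∀ x, π (π (π x)) = x) ↔ orderOf π ∣ 3 := by
    rw [orderOf_dvd_iff_pow_eq_one, Equiv.ext_iff]
    rfl
  rw [h1, ← Equiv.Perm.lcm_cycleType, Multiset.lcm_dvd, HasCycleLengthsIn,
    Equiv.Perm.parts_partition]
  constructor
  · intro h l hl
    rcases h l (Multiset.mem_add.2 (Or.inl hl)) with rfl | rfl <;> norm_num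
  · intro h l hl
    rcases Multiset.mem_add.1 hl with hl | hl
    · exact (Nat.dvd_prime Nat.prime_three).1 (h l hl)
    · exact Or.inl (Multiset.eq_of_mem_replicate hl)

theorem containsPattern132_iff {n : ℕ} (π : Equiv.Perm (Fin n)) :
    ContainsPattern π pattern132 ↔ ∃ i j k, i < j ∧ j < k ∧ π i < π k ∧ π k < π j := by
  have h0 : pattern132 0 = 0 := by decide
  have h1 : pattern132 1 = 2 := by decide
  have h2 : pattern132 2 = 1 := by decide
  constructor
  · rintro ⟨f, hf, h⟩
    refine ⟨f 0, f 1, f 2, hf (by decide), hf (by decide), (h 0 2).2 ?_, (h 2 1).2 ?_⟩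
    · rw [h0, h2]; decide
    · rw [h1, h2]; decide
  · rintro ⟨i, j, k, hij, hjk, hik, hkj⟩
    refine ⟨![i, j, k], ?_, ?_⟩
    · rw [Fin.strictMono_iff_lt_succ]
      intro a
      fin_cases a <;> simpa
    · intro a b
      have := hik.trans hkj
      fin_cases a <;> fin_cases b <;> simp [*, le_of_lt]

/-- The extension of a permutation of `Fin n` to `ℕ` by fixed points. -/
def extendFin {n : ℕ} (π : Equiv.Perm (Fin n)) (x : ℕ) : ℕ := if h : x < n then π ⟨x, h⟩ else x

theorem extendFin_of_lt {n : ℕ} (π : Equiv.Perm (Fin n)) {x : ℕ} (h : x < n) :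
    extendFin π x = π ⟨x, h⟩ := dif_pos h

theorem extendFin_of_le {n : ℕ} (π : Equiv.Perm (Fin n)) {x : ℕ} (h : n ≤ x) :
    extendFin π x = x := dif_neg (by omega)

theorem extendFin_mem {n : ℕ} (π : Equiv.Perm (Fin n)) (h : ∀ x, π (π (π x)) = x)
    (hp : ¬ ContainsPattern π pattern132) : extendFin π ∈ cubicAvoiders n := by
  refine ⟨fun x hx => extendFin_of_le π hx, fun x => ?_, fun i j k hij hjk h1 h2 => ?_⟩
  · by_cases hx : x < n
    · rw [extendFin_of_lt π hx, extendFin_of_lt π (Fin.is_lt _), extendFin_of_lt π (Fin.is_lt _)]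
      simp only [Fin.eta, h]
    · simp only [extendFin_of_le π (not_lt.1 hx)]
  · by_cases hk : k < n
    · rw [extendFin_of_lt π hk] at h1 h2
      rw [extendFin_of_lt π (show i < n by omega)] at h1
      rw [extendFin_of_lt π (show j < n by omega)] at h2
      exact hp ((containsPattern132_iff π).2
        ⟨_, _, _, Fin.mk_lt_mk.2 hij, Fin.mk_lt_mk.2 hjk, h1, h2⟩)
    · rw [extendFin_of_le π (not_lt.1 hk)] at h2
      by_cases hj : j < n
      · rw [extendFin_of_lt π hj] at h2
        have := (π ⟨j, hj⟩).2
        omega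
      · rw [extendFin_of_le π (not_lt.1 hj)] at h2
        omega

theorem extendFin_bijective (n : ℕ) : Function.Bijective
    (fun π : {π : Equiv.Perm (Fin n) // HasCycleLengthsIn {1, 3} π ∧
        ¬ ContainsPattern π pattern132} =>
      (⟨extendFin π.1, extendFin_mem π.1 ((hasCycleLengthsIn_one_three_iff _).1 π.2.1) π.2.2⟩ :
        cubicAvoiders n)) := by
  constructor
  · rintro ⟨π, hπ⟩ ⟨τ, hτ⟩ h
    apply Subtype.ext
    ext x
    have := congrFun (congrArg Subtype.val h) x
    simpa only [extendFin_of_lt _ x.2] using this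
  · rintro ⟨f, hf⟩
    have hlt : ∀ x, x < n → f x < n := fun x hx =>
      lt_of_fixes_from (injective_of_cube hf.2.1) hf.1 hx
    let π : Equiv.Perm (Fin n) :=
      { toFun := fun x => ⟨f x, hlt x x.2⟩
        invFun := fun x => ⟨f (f x), hlt _ (hlt x x.2)⟩
        left_inv := fun x => Fin.ext (hf.2.1 x)
        right_inv := fun x => Fin.ext (hf.2.1 x) }
    refine ⟨⟨π, (hasCycleLengthsIn_one_three_iff _).2 fun x => Fin.ext (hf.2.1 x), ?_⟩, ?_⟩
    · rw [containsPattern132_iff]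
      rintro ⟨i, j, k, hij, hjk, h1, h2⟩
      exact hf.2.2 i j k hij hjk h1 h2
    · apply Subtype.ext
      funext x
      by_cases hx : x < n
      · exact extendFin_of_lt π hx
      · exact (extendFin_of_le π (not_lt.1 hx)).trans (hf.1 x (not_lt.1 hx)).symm

theorem numAvoiding_eq (n : ℕ) : numAvoiding {1, 3} pattern132 n = numWithGaps 1 n := by
  rw [numWithGaps_one]
  exact Nat.card_congr (Equiv.ofBijective _ (extendFin_bijective n))

/-! ### Generating functions of the avoiders -/

section series

open PowerSeries

theorem eq_zero_of_X_pow_dvd {f : ℚ⟦X⟧} (h : ∀ i, (X : ℚ⟦X⟧) ^ i ∣ f) : f = 0 := by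
  ext n
  exact X_pow_dvd_iff.1 (h (n + 1)) n (Nat.lt_succ_self n)

theorem catalanSeries_rat_eq :
    PowerSeries.map (Nat.castRingHom ℚ) catalanSeries =
      1 + X * PowerSeries.map (Nat.castRingHom ℚ) catalanSeries ^ 2 := by
  have h := congrArg (PowerSeries.map (Nat.castRingHom ℚ)) catalanSeries_sq_mul_X_add_one
  simp only [map_add, map_mul, map_pow, map_one, PowerSeries.map_X] at h
  linear_combination -h

theorem catalanCube_eq : catalanCube = 1 + X ^ 3 * catalanCube ^ 2 := by
  have h := congrArg (PowerSeries.expand 3 (by norm_num)) catalanSeries_rat_eq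
  simp only [map_add, map_mul, map_pow, map_one, PowerSeries.expand_X] at h
  exact h

/-- The Catalan series may be evaluated at any series without constant term. -/
theorem exists_eq_one_add_mul_sq {u : ℚ⟦X⟧} (hu : constantCoeff u = 0) :
    ∃ k : ℚ⟦X⟧, k = 1 + u * k ^ 2 := by
  have hs : HasSubst u := HasSubst.of_constantCoeff_zero' hu
  refine ⟨substAlgHom (R := ℚ) hs (PowerSeries.map (Nat.castRingHom ℚ) catalanSeries), ?_⟩
  have h := congrArg (substAlgHom (R := ℚ) hs) catalanSeries_rat_eq
  simpa only [map_add, map_mul, map_pow, map_one, substAlgHom_X] using h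

/-- The generating function of the blocks by their number of elements is `z³ c(z³)`. -/
theorem coeff_X_pow_mul_catalanCube (a : ℕ) :
    coeff a (X ^ 3 * catalanCube) = (Nat.card (blocks a) : ℚ) := by
  rw [(finite_and_card_blocks a).2, coeff_X_pow_mul', catalanCube, coeff_expand]
  by_cases h : 3 ∣ a ∧ a ≠ 0
  · rw [if_pos h, if_pos (by omega), if_pos (by omega), coeff_map, catalanSeries_coeff,
      show (a - 3) / 3 = a / 3 - 1 by omega]
    rfl
  · rw [if_neg h]
    split_ifs
    · omega
    · rfl
    · simp

/-- The generating function of the avoiders of order three with at least `i` gaps. -/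
noncomputable def gapSeries (i : ℕ) : ℚ⟦X⟧ := PowerSeries.mk fun n => (numWithGaps i n : ℚ)

theorem gapSeries_one : gapSeries 1 = avoidingSeries {1, 3} pattern132 := by
  ext n
  rw [gapSeries, avoidingSeries, coeff_mk, coeff_mk, numAvoiding_eq]

theorem gapSeries_one_eq : gapSeries 1 = 1 + X * gapSeries 1 + 2 * gapSeries 2 := by
  ext n
  rw [map_add, map_add, two_mul, map_add]
  cases n with
  | zero =>
    have h : numWithGaps 1 0 = 1 := by rw [numWithGaps_one, card_cubicAvoiders_zero]
    simp [gapSeries, h, numWithGaps_two_zero]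
  | succ n =>
    rw [coeff_succ_X_mul]
    simp only [gapSeries, coeff_mk, numWithGaps_one, card_cubicAvoiders_succ, coeff_one]
    push_cast
    simp
    ring

theorem gapSeries_succ (i : ℕ) (hi : 1 ≤ i) :
    gapSeries (i + 1) = gapSeries (i + 2) + X ^ 3 * catalanCube * gapSeries i := by
  ext n
  rw [map_add, coeff_mul]
  simp only [coeff_X_pow_mul_catalanCube, gapSeries, coeff_mk]
  rw [numWithGaps_succ (i + 1), card_gaps_eq i n hi]
  push_cast
  rfl

theorem X_pow_dvd_gapSeries (i : ℕ) : (X : ℚ⟦X⟧) ^ i ∣ gapSeries (i + 1) := by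
  rw [X_pow_dvd_iff]
  intro m hm
  rw [gapSeries, coeff_mk, numWithGaps_eq_zero (by omega), Nat.cast_zero]

/-- The series of the avoiders with a nonzero gap is `w` times that of all avoiders, where `w` is
the small solution of `w = u + w²`: the error of `gapSeries (i + 2) = w * gapSeries (i + 1)` gets
multiplied by the unit `1 - w` in each step, while the series themselves tend to `0`. -/
theorem gapSeries_two_eq {w : ℚ⟦X⟧} (hw : w = X ^ 3 * catalanCube + w ^ 2)
    (hw0 : constantCoeff w = 0) : gapSeries 2 = w * gapSeries 1 := by
  have hrec : ∀ i, gapSeries (i + 2) - w * gapSeries (i + 1) =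
      (1 - w) ^ i * (gapSeries 2 - w * gapSeries 1) := by
    intro i
    induction i with
    | zero => simp
    | succ i ih =>
      have h := gapSeries_succ (i + 1) (by omega)
      rw [pow_succ', mul_assoc, ← ih]
      linear_combination -h + gapSeries (i + 1) * hw
  have hunit : IsUnit (1 - w) := by
    rw [PowerSeries.isUnit_iff_constantCoeff]
    simp [hw0]
  refine sub_eq_zero.1 (eq_zero_of_X_pow_dvd fun i => ?_)
  have hd : (X : ℚ⟦X⟧) ^ i ∣ (1 - w) ^ i * (gapSeries 2 - w * gapSeries 1) := by
    rw [← hrec i]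
    exact dvd_sub ((pow_dvd_pow _ (Nat.le_succ i)).trans (X_pow_dvd_gapSeries (i + 1)))
      ((X_pow_dvd_gapSeries i).mul_left _)
  exact ((hunit.pow i).dvd_mul_left).1 hd

theorem avoidingSeries_mul_eq_one {w : ℚ⟦X⟧} (hw : w = X ^ 3 * catalanCube + w ^ 2)
    (hw0 : constantCoeff w = 0) :
    avoidingSeries {1, 3} pattern132 * (1 - X - 2 * w) = 1 := by
  rw [← gapSeries_one]
  linear_combination gapSeries_one_eq + 2 * gapSeries_two_eq hw hw0

end series

/-! ### Motzkin paths by their starting height -/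

/-- A path that starts at height `h`, ends at height `0` and never goes below height `0`. -/
def IsPathFrom (h : ℤ) (w : List MotzkinStep) : Prop :=
  h + pathHeight w = 0 ∧ ∀ i ≤ w.length, 0 ≤ h + pathHeight (w.take i)

/-- The number of flat steps at height `0` of a path that starts at height `h`. -/
noncomputable def flatsFrom (h : ℤ) (w : List MotzkinStep) : ℕ :=
  Nat.card {i : Fin w.length // w.get i = MotzkinStep.flat ∧ h + pathHeight (w.take i) = 0}

theorem pathHeight_cons (s : MotzkinStep) (w : List MotzkinStep) :
    pathHeight (s :: w) = s.rise + pathHeight w := by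
  simp [pathHeight]

theorem pathHeight_nil : pathHeight [] = 0 := rfl

theorem isPathFrom_nil (h : ℤ) : IsPathFrom h [] ↔ h = 0 := by
  simp only [IsPathFrom, pathHeight_nil, List.take_nil, add_zero, List.length_nil]
  exact ⟨fun h => h.1, fun h => ⟨h, fun _ _ => h.ge⟩⟩

theorem isPathFrom_cons (h : ℤ) (s : MotzkinStep) (w : List MotzkinStep) :
    IsPathFrom h (s :: w) ↔ 0 ≤ h ∧ IsPathFrom (h + s.rise) w := by
  simp only [IsPathFrom, pathHeight_cons, List.length_cons, add_assoc]
  constructor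
  · rintro ⟨h1, h2⟩
    refine ⟨by simpa [pathHeight_nil] using h2 0 (Nat.zero_le _), h1, fun i hi => ?_⟩
    simpa [pathHeight_cons] using h2 (i + 1) (by omega)
  · rintro ⟨h0, h1, h2⟩
    refine ⟨h1, fun i hi => ?_⟩
    cases i with
    | zero => simpa [pathHeight_nil] using h0
    | succ i => simpa [pathHeight_cons] using h2 i (by omega)

theorem flatsFrom_nil (h : ℤ) : flatsFrom h [] = 0 := by
  have : IsEmpty (Fin ([] : List MotzkinStep).length) := Fin.isEmpty
  exact Nat.card_of_isEmpty

open scoped Classical in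
theorem flatsFrom_cons (h : ℤ) (s : MotzkinStep) (w : List MotzkinStep) :
    flatsFrom h (s :: w) =
      (if s = MotzkinStep.flat ∧ h = 0 then 1 else 0) + flatsFrom (h + s.rise) w := by
  rw [flatsFrom, flatsFrom, Nat.card_eq_fintype_card, Nat.card_eq_fintype_card,
    Fintype.card_subtype, Fintype.card_subtype, Finset.card_filter, Finset.card_filter]
  simp only [List.length_cons]
  rw [Fin.sum_univ_succ]
  simp [pathHeight_nil, pathHeight_cons, add_assoc]

theorem finite_words (k : ℕ) (P : List MotzkinStep → Prop) :
    {w : List MotzkinStep | w.length = k ∧ P w}.Finite := by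
  have : Finite MotzkinStep :=
    Finite.of_surjective (fun i : Fin 3 => ![MotzkinStep.up, .flat, .down] i) (by
      intro s
      cases s
      · exact ⟨0, rfl⟩
      · exact ⟨1, rfl⟩
      · exact ⟨2, rfl⟩)
  exact (List.finite_length_eq MotzkinStep k).subset fun w hw => hw.1

theorem ncard_words_succ (k : ℕ) (P : List MotzkinStep → Prop) :
    {w : List MotzkinStep | w.length = k + 1 ∧ P w}.ncard =
      {w : List MotzkinStep | w.length = k ∧ P (.up :: w)}.ncard +
      {w : List MotzkinStep | w.length = k ∧ P (.flat :: w)}.ncard +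
      {w : List MotzkinStep | w.length = k ∧ P (.down :: w)}.ncard := by
  have hinj : ∀ s : MotzkinStep, Function.Injective (s :: ·) := fun s => List.cons_injective
  have hS : {w : List MotzkinStep | w.length = k + 1 ∧ P w} =
      (((.up :: ·) '' {w : List MotzkinStep | w.length = k ∧ P (.up :: w)}) ∪
      ((.flat :: ·) '' {w : List MotzkinStep | w.length = k ∧ P (.flat :: w)})) ∪
      ((.down :: ·) '' {w : List MotzkinStep | w.length = k ∧ P (.down :: w)}) := by
    ext w
    constructor
    · rintro ⟨h1, h2⟩
      cases w with
      | nil => simp at h1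
      | cons s w =>
        have h3 : w.length = k := by simpa using h1
        cases s
        · exact Or.inl (Or.inl ⟨w, ⟨h3, h2⟩, rfl⟩)
        · exact Or.inl (Or.inr ⟨w, ⟨h3, h2⟩, rfl⟩)
        · exact Or.inr ⟨w, ⟨h3, h2⟩, rfl⟩
    · rintro ((⟨w, ⟨h1, h2⟩, rfl⟩ | ⟨w, ⟨h1, h2⟩, rfl⟩) | ⟨w, ⟨h1, h2⟩, rfl⟩) <;>
        exact ⟨by simpa using h1, h2⟩
  rw [hS, Set.ncard_union_eq _ (((finite_words _ _).image _).union ((finite_words _ _).image _))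
      ((finite_words _ _).image _),
    Set.ncard_union_eq _ ((finite_words _ _).image _) ((finite_words _ _).image _),
    Set.ncard_image_of_injective _ (hinj _), Set.ncard_image_of_injective _ (hinj _),
    Set.ncard_image_of_injective _ (hinj _)]
  · rw [Set.disjoint_left]
    rintro _ ⟨w, -, rfl⟩ ⟨w', -, h⟩
    simp at h
  · rw [Set.disjoint_left]
    rintro _ (⟨w, -, rfl⟩ | ⟨w, -, rfl⟩) ⟨w', -, h⟩ <;> simp at h

/-- The number of paths of length `k` from height `h` to height `0` with `j` flat steps at height
`0`. -/
noncomputable def pathCount (k h j : ℕ) : ℕ :=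
  {w : List MotzkinStep | w.length = k ∧ IsPathFrom h w ∧ flatsFrom h w = j}.ncard

theorem pathCount_zero (h j : ℕ) : pathCount 0 h j = if h = 0 ∧ j = 0 then 1 else 0 := by
  split_ifs with hc
  · obtain ⟨rfl, rfl⟩ := hc
    have : {w : List MotzkinStep | w.length = 0 ∧ IsPathFrom (0 : ℕ) w ∧ flatsFrom (0 : ℕ) w = 0} =
        {[]} := by
      ext w
      constructor
      · intro hw; exact List.length_eq_zero_iff.1 hw.1
      · rintro rfl; exact ⟨rfl, (isPathFrom_nil _).2 rfl, flatsFrom_nil _⟩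
    rw [pathCount, this, Set.ncard_singleton]
  · have : {w : List MotzkinStep | w.length = 0 ∧ IsPathFrom h w ∧ flatsFrom h w = j} = ∅ := by
      ext w
      refine ⟨?_, fun h => h.elim⟩
      rintro ⟨h1, h2, h3⟩
      obtain rfl := List.length_eq_zero_iff.1 h1
      rw [isPathFrom_nil] at h2
      rw [flatsFrom_nil] at h3
      exact hc ⟨by exact_mod_cast h2, h3.symm⟩
    rw [pathCount, this, Set.ncard_empty]

theorem ncard_eq_pathCount {k j h : ℕ} {P : List MotzkinStep → Prop}
    (hP : ∀ w, P w ↔ IsPathFrom h w ∧ flatsFrom h w = j) :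
    {w : List MotzkinStep | w.length = k ∧ P w}.ncard = pathCount k h j := by
  simp only [hP, pathCount]

theorem ncard_eq_zero_of_forall_not {k : ℕ} {P : List MotzkinStep → Prop} (hP : ∀ w, ¬ P w) :
    {w : List MotzkinStep | w.length = k ∧ P w}.ncard = 0 := by
  simp [hP]

theorem not_isPathFrom_neg (w : List MotzkinStep) : ¬ IsPathFrom (-1) w := fun h => by
  have := h.2 0 (Nat.zero_le _)
  simp [pathHeight_nil] at this

theorem pathCount_succ_zero_zero (k : ℕ) : pathCount (k + 1) 0 0 = pathCount k 1 0 := by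
  rw [pathCount, ncard_words_succ, ncard_eq_pathCount (h := 1) (j := 0),
    ncard_eq_zero_of_forall_not, ncard_eq_zero_of_forall_not, add_zero, add_zero]
  · intro w
    simp [isPathFrom_cons, MotzkinStep.rise, not_isPathFrom_neg]
  · intro w
    simp [flatsFrom_cons]
  · intro w
    simp [isPathFrom_cons, flatsFrom_cons, MotzkinStep.rise]

theorem pathCount_succ_zero_succ (k j : ℕ) :
    pathCount (k + 1) 0 (j + 1) = pathCount k 1 (j + 1) + pathCount k 0 j := by
  rw [pathCount, ncard_words_succ, ncard_eq_pathCount (h := 1) (j := j + 1),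
    ncard_eq_pathCount (h := 0) (j := j), ncard_eq_zero_of_forall_not, add_zero]
  · intro w
    simp [isPathFrom_cons, MotzkinStep.rise, not_isPathFrom_neg]
  · intro w
    simp [isPathFrom_cons, flatsFrom_cons, MotzkinStep.rise, add_comm 1]
  · intro w
    simp [isPathFrom_cons, flatsFrom_cons, MotzkinStep.rise]

theorem pathCount_succ_succ (k h j : ℕ) :
    pathCount (k + 1) (h + 1) j = pathCount k (h + 2) j + pathCount k (h + 1) j +
      pathCount k h j := by
  have h0 : (0 : ℤ) ≤ (h : ℤ) + 1 := by positivity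
  have h1 : (h : ℤ) + 1 ≠ 0 := by positivity
  have h2 : (h : ℤ) + 1 + 1 = h + 2 := by ring
  rw [pathCount, ncard_words_succ, ncard_eq_pathCount (h := h + 2) (j := j),
    ncard_eq_pathCount (h := h + 1) (j := j), ncard_eq_pathCount (h := h) (j := j)]
  · intro w
    simp [isPathFrom_cons, flatsFrom_cons, MotzkinStep.rise, h0]
  · intro w
    simp [isPathFrom_cons, flatsFrom_cons, MotzkinStep.rise, h0, h1]
  · intro w
    simp [isPathFrom_cons, flatsFrom_cons, MotzkinStep.rise, h0, h2]

theorem motzkinCount_eq_pathCount (k j : ℕ) : motzkinCount k j = pathCount k 0 j := by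
  rw [motzkinCount, pathCount, ← Nat.card_coe_set_eq]
  refine Nat.card_congr (Equiv.subtypeEquivRight fun w => ?_)
  simp [IsMotzkinPath, IsPathFrom, flatsAtLevelZero, flatsFrom]

/-- The generating polynomial, by the number of flat steps at height `0`, of the paths of length `k`
from height `h` to height `0`, computed by removing the first step. -/
noncomputable def pathPoly : ℕ → ℕ → Polynomial ℚ
  | 0, 0 => 1
  | 0, _ + 1 => 0
  | k + 1, 0 => pathPoly k 1 + Polynomial.X * pathPoly k 0
  | k + 1, h + 1 => pathPoly k (h + 2) + pathPoly k (h + 1) + pathPoly k h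

theorem coeff_pathPoly (k h j : ℕ) : (pathPoly k h).coeff j = pathCount k h j := by
  induction k generalizing h j with
  | zero =>
    rw [pathCount_zero]
    cases h with
    | zero => simp [pathPoly, Polynomial.coeff_one]
    | succ h => simp [pathPoly]
  | succ k ih =>
    cases h with
    | zero =>
      cases j with
      | zero => simp [pathPoly, ih, pathCount_succ_zero_zero]
      | succ j => simp [pathPoly, ih, pathCount_succ_zero_succ]
    | succ h => simp [pathPoly, ih, pathCount_succ_succ]

theorem coeff_motzkinSeries (k : ℕ) : PowerSeries.coeff k motzkinSeries = pathPoly k 0 := by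
  ext j
  rw [motzkinSeries, PowerSeries.coeff_mk, Polynomial.finsetSum_coeff, coeff_pathPoly,
    ← motzkinCount_eq_pathCount]
  simp only [Polynomial.coeff_C_mul, Polynomial.coeff_X_pow, mul_ite, mul_one, mul_zero,
    Finset.sum_ite_eq, Finset.mem_range]
  split_ifs with h
  · rfl
  · rw [motzkinCount_eq_zero (by omega), Nat.cast_zero]

/-! ### Evaluation of the Motzkin series -/

section evaluation

open PowerSeries

theorem coeff_mul_partialEval (G : PowerSeries (Polynomial ℚ)) (t x y : ℚ⟦X⟧)
    (hx : constantCoeff x = 0) {n N : ℕ} (h : n < N) :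
    coeff n (y * partialEval G t x N) = coeff n (y * evalSeries G t x) := by
  rw [coeff_mul, coeff_mul]
  refine Finset.sum_congr rfl fun p hp => ?_
  rw [coeff_partialEval_eq G t x hx]
  have := Finset.HasAntidiagonal.mem_antidiagonal.1 hp
  omega

theorem evalSeries_mk_succ (a : ℕ → Polynomial ℚ) (t x : ℚ⟦X⟧) (hx : constantCoeff x = 0) :
    evalSeries (PowerSeries.mk a) t x =
      Polynomial.aeval t (a 0) + x * evalSeries (PowerSeries.mk fun k => a (k + 1)) t x := by
  ext n
  rw [← coeff_partialEval_eq _ t x hx (show n < (n + 1) + 1 by omega), map_add,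
    ← coeff_mul_partialEval _ t x x hx (Nat.lt_succ_self n), ← map_add]
  congr 1
  rw [partialEval, Finset.sum_range_succ', partialEval, Finset.mul_sum, add_comm]
  simp only [coeff_mk, pow_zero, mul_one]
  congr 1
  exact Finset.sum_congr rfl fun k _ => by ring

theorem evalSeries_mk_add (a b : ℕ → Polynomial ℚ) (t x : ℚ⟦X⟧) :
    evalSeries (PowerSeries.mk fun k => a k + b k) t x =
      evalSeries (PowerSeries.mk a) t x + evalSeries (PowerSeries.mk b) t x := by
  ext n
  simp only [evalSeries, partialEval, coeff_mk, map_add, add_mul, Finset.sum_add_distrib]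

theorem evalSeries_mk_X_mul (a : ℕ → Polynomial ℚ) (t x : ℚ⟦X⟧) (hx : constantCoeff x = 0) :
    evalSeries (PowerSeries.mk fun k => Polynomial.X * a k) t x =
      t * evalSeries (PowerSeries.mk a) t x := by
  ext n
  rw [← coeff_mul_partialEval _ t x t hx (Nat.lt_succ_self n), evalSeries, coeff_mk]
  congr 1
  rw [partialEval, partialEval, Finset.mul_sum]
  refine Finset.sum_congr rfl fun k _ => ?_
  rw [coeff_mk, coeff_mk, map_mul, Polynomial.aeval_X, mul_assoc]

/-- The value at `(t, x)` of the generating function of the paths from height `h`. -/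
noncomputable def pathEval (t x : ℚ⟦X⟧) (h : ℕ) : ℚ⟦X⟧ :=
  evalSeries (PowerSeries.mk fun k => pathPoly k h) t x

theorem pathEval_zero (t x : ℚ⟦X⟧) (hx : constantCoeff x = 0) :
    pathEval t x 0 = 1 + x * (pathEval t x 1 + t * pathEval t x 0) := by
  conv_lhs => rw [pathEval, evalSeries_mk_succ _ t x hx]
  simp only [pathPoly, map_one]
  rw [evalSeries_mk_add, evalSeries_mk_X_mul _ t x hx]
  rfl

theorem pathEval_succ (t x : ℚ⟦X⟧) (hx : constantCoeff x = 0) (h : ℕ) :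
    pathEval t x (h + 1) = x * (pathEval t x (h + 2) + pathEval t x (h + 1) + pathEval t x h) := by
  conv_lhs => rw [pathEval, evalSeries_mk_succ _ t x hx]
  simp only [pathPoly, map_zero, zero_add]
  rw [evalSeries_mk_add, evalSeries_mk_add]
  rfl

/-- The series of the paths from height `1` is `y` times that of the paths from height `0`, where
`y` is the small solution of `y = x (1 + y + y²)`: by the first-step recursion, the error of
`pathEval (h + 1) = y * pathEval h` at height `0` is divisible by every power of `x`. -/
theorem pathEval_one (t x : ℚ⟦X⟧) (hx : constantCoeff x = 0) {y : ℚ⟦X⟧}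
    (hy : y = x * (1 + y + y ^ 2)) : pathEval t x 1 = y * pathEval t x 0 := by
  have hrec : ∀ h, (1 - x - x * y) ^ h * (pathEval t x 1 - y * pathEval t x 0) =
      x ^ h * (pathEval t x (h + 1) - y * pathEval t x h) := by
    intro h
    induction h with
    | zero => simp
    | succ h ih =>
      have h1 := pathEval_succ t x hx h
      rw [pow_succ', mul_assoc, ih]
      linear_combination x ^ h * h1 - x ^ h * pathEval t x h * hy
  have hunit : IsUnit (1 - x - x * y) := by
    rw [PowerSeries.isUnit_iff_constantCoeff]
    simp [hx]
  refine sub_eq_zero.1 (eq_zero_of_X_pow_dvd fun i => ?_)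
  have hd : (X : ℚ⟦X⟧) ^ i ∣ (1 - x - x * y) ^ i * (pathEval t x 1 - y * pathEval t x 0) := by
    rw [hrec i]
    exact (pow_dvd_pow_of_dvd (X_dvd_iff.2 hx) i).mul_right _
  exact ((hunit.pow i).dvd_mul_left).1 hd

theorem pathEval_zero_mul_eq_one (t x : ℚ⟦X⟧) (hx : constantCoeff x = 0) {y : ℚ⟦X⟧}
    (hy : y = x * (1 + y + y ^ 2)) : pathEval t x 0 * (1 - x * t - x * y) = 1 := by
  linear_combination pathEval_zero t x hx + x * pathEval_one t x hx hy

theorem evalSeries_seriesF (t x : ℚ⟦X⟧) (hx : constantCoeff x = 0) :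
    evalSeries seriesF t x = 1 + x * (t * pathEval t x 0) := by
  have hF : seriesF = PowerSeries.mk fun k => coeff k seriesF := by
    ext k
    rw [coeff_mk]
  have h0 : coeff 0 seriesF = 1 := by
    rw [seriesF, map_add, mul_assoc, coeff_zero_X_mul]
    simp
  have hs : ∀ k, coeff (k + 1) seriesF = Polynomial.X * pathPoly k 0 := by
    intro k
    rw [seriesF, map_add, mul_assoc, coeff_succ_X_mul, coeff_C_mul, coeff_motzkinSeries]
    simp [coeff_one]
  rw [hF, evalSeries_mk_succ _ t x hx, h0, map_one]
  simp only [hs]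
  rw [evalSeries_mk_X_mul _ t x hx]
  rfl

end evaluation

/-! ### The two formulas -/

section formulas

open PowerSeries

/-- There are series `u = z³ c(z³)`, `k = c(u)` and `w = u k`, in terms of which both formulas are
identities of polynomials. -/
theorem exists_catalan_of_catalan : ∃ k : ℚ⟦X⟧, k = 1 + X ^ 3 * catalanCube * k ^ 2 ∧
    X ^ 3 * catalanCube * k = X ^ 3 * catalanCube + (X ^ 3 * catalanCube * k) ^ 2 ∧
    constantCoeff (X ^ 3 * catalanCube * k) = 0 := by
  have h0 : constantCoeff (X ^ 3 * catalanCube) = (0 : ℚ) := by simp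
  obtain ⟨k, hk⟩ := exists_eq_one_add_mul_sq h0
  exact ⟨k, hk, by linear_combination X ^ 3 * catalanCube * hk, by rw [map_mul, h0, zero_mul]⟩

theorem constantCoeff_catalanCube : constantCoeff catalanCube = 1 := by
  have h := constantCoeff_catalanCube_sub_one
  rw [map_sub, map_one, sub_eq_zero] at h
  exact h

theorem IsSqrtSeries.unique {s t f : ℚ⟦X⟧} (hs : IsSqrtSeries s f) (ht : IsSqrtSeries t f) :
    s = t := by
  have h : (s - t) * (s + t) = 0 := by linear_combination hs.1 - ht.1
  rcases mul_eq_zero.1 h with h | h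
  · exact sub_eq_zero.1 h
  · have h2 := congrArg constantCoeff h
    rw [map_add, hs.2, ht.2, map_zero] at h2
    norm_num at h2

theorem isSqrtSeries_catalanCube {w : ℚ⟦X⟧} (hw : w = X ^ 3 * catalanCube + w ^ 2)
    (hw0 : constantCoeff w = 0) :
    IsSqrtSeries (catalanCube * (1 - 2 * w)) (catalanCube * (4 - 3 * catalanCube)) := by
  refine ⟨?_, ?_⟩
  · linear_combination -4 * catalanCube ^ 2 * hw + 4 * catalanCube * catalanCube_eq
  · simp [constantCoeff_catalanCube, hw0]

end formulas

theorem mainTheorem1 :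
    avoidingSeries {1, 3} pattern132 =
        (1 - PowerSeries.X)⁻¹ *
          evalSeries seriesF (2 * (1 - PowerSeries.X)⁻¹) (catalanCube - 1) ∧
      (∃! s : PowerSeries ℚ, IsSqrtSeries s (catalanCube * (4 - 3 * catalanCube))) ∧
      ∀ s : PowerSeries ℚ, IsSqrtSeries s (catalanCube * (4 - 3 * catalanCube)) →
        avoidingSeries {1, 3} pattern132 =
          catalanCube * (s - PowerSeries.X * catalanCube)⁻¹ := by
  obtain ⟨k, hk, hw, hw0⟩ := exists_catalan_of_catalan
  have hc := catalanCube_eq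
  have hA := avoidingSeries_mul_eq_one hw hw0
  have hs := isSqrtSeries_catalanCube hw hw0
  refine ⟨?_, ⟨_, hs, fun t ht => ht.unique hs⟩, fun s hs' => ?_⟩
  · have hv : (1 - PowerSeries.X : PowerSeries ℚ)⁻¹ * (1 - PowerSeries.X) = 1 :=
      PowerSeries.inv_mul_cancel _ (by simp)
    have hx := constantCoeff_catalanCube_sub_one
    rw [evalSeries_seriesF _ _ hx]
    generalize (1 - PowerSeries.X : PowerSeries ℚ)⁻¹ = v at *
    -- The solution of `y = x (1 + y + y²)` at `x = c(z³) - 1` is `k - 1`.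
    have hy : k - 1 = (catalanCube - 1) * (1 + (k - 1) + (k - 1) ^ 2) := by
      linear_combination -k ^ 2 * hc + catalanCube * hk
    have hP := pathEval_zero_mul_eq_one (2 * v) _ hx hy
    generalize pathEval (2 * v) (catalanCube - 1) 0 = P at *
    generalize avoidingSeries {1, 3} pattern132 = A at *
    have hwx : PowerSeries.X ^ 3 * catalanCube * k * (1 - (catalanCube - 1) * (k - 1)) =
        catalanCube - 1 := by
      linear_combination (catalanCube - 1) * hk - k * hc
    have hB : v * (1 + (catalanCube - 1) * (2 * v * P)) *
        (1 - PowerSeries.X - 2 * (PowerSeries.X ^ 3 * catalanCube * k)) = 1 := by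
      linear_combination (1 + (catalanCube - 1) * (2 * v * P)) * hv - 2 * v * P * hwx +
        2 * (PowerSeries.X ^ 3 * catalanCube * k) * v * hP
    linear_combination v * (1 + (catalanCube - 1) * (2 * v * P)) * hA - A * hB
  · rw [hs'.unique hs, PowerSeries.eq_mul_inv_iff_mul_eq]
    · linear_combination catalanCube * hA
    · simp [constantCoeff_catalanCube, hw0]
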